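/- Let $\mathcal H$ be a complex Hilbert space of finite dimension $n$ and let $r_1,\dots,r_m$ be natural numbers with $\sum_{i=1}^m r_i=n$. An \emph{ensemble} $\widetilde P=\{p_i,\rho_i\}_{i=1}^m$ consists of probabilities $p_i>0$ with $\sum_i p_i=1$ and density operators $\rho_i\ge 0$, $\operatorname{Tr}\rho_i=1$, on $\mathcal H$. Let $\mathcal E(r_1,\dots,r_m)$ be the set of ensembles of linearly independent states with $\operatorname{rank}\rho_i=r_i$ for all $i$, i.e. such that the supports of $\rho_1,\dots,\rho_m$ are linearly independent subspaces of dimensions $r_1,\dots,r_m$. An $m$-element POVM $\{\Pi_i\}$ ($\Pi_i\ge0$, $\sum_i\Pi_i=\mathbb 1$) is \emph{optimal} for $\widetilde P$ if it maximizes $\sum_i p_i\operatorname{Tr}(\rho_i\Pi_i)$ among all $m$-element POVMs. Let $\mathcal P(r_1,\dots,r_m)$ be the set of POVMs with $\Pi_i\Pi_j=\delta_{ij}\Pi_i$ and $\operatorname{rank}\Pi_i=r_i$, and put $$PGM(\{q_i,\sigma_i\})=\Big\{\big(\textstyle\sum_j q_j\sigma_j\big)^{-1/2}q_i\sigma_i\big(\sum_k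 q_k\sigma_k\big)^{-1/2}\Big\}_{i=1}^m .$$ For $\widetilde P\in\mathcal E(r_1,\dots,r_m)$ construct an ensemble $\widetilde Q=\{q_i,\sigma_i\}$ as follows. Let $\{\Pi_i\}$ be an optimal POVM for $\widetilde P$. Write $p_i\rho_i=\sum_{j=1}^{r_i}|\psi_{ij}\rangle\langle\psi_{ij}|$, let $G$ be the Gram matrix of the vectors $\psi_{ij}$ (an $n\times n$ matrix with blocks of sizes $r_1,\dots,r_m$), and let $u_{ij}$ be the dual system, $\langle\psi_{ij}|u_{kl}\rangle=\delta_{ik}\delta_{jl}$. Choose a unitary matrix $W$ such that the vectors $w_{ij}=\sum_{l,k}(G^{1/2}W)^{(l\,i)}_{k\,j}\,u_{lk}$ satisfy $\Pi_i=\sum_{j=1}^{r_i}|w_{ij}\rangle\langle w_{ij}|$ for all $i$, and such that every diagonal block $X^{(ii)}$ of $G^{1/2}W$ is positive semidefinite. Put $\chi_{ij}=\sum_{k=1}^{r_i}X^{(ii)}_{kj}\psi_{ik}$ and $$\sigma_i=\frac{\sum_{j}|\chi_{ij}\rangle\langle\chi_{ij}|}{\sum_{k}\langle\chi_{ik}|\chi_{ik}\rangle},\qquad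 q_i=\frac{\sum_{j}\langle\chi_{ij}|\chi_{ij}\rangle}{\sum_{l,k}\langle\chi_{lk}|\chi_{lk}\rangle}.$$ \textbf{Theorem.} For every $\widetilde P\in\mathcal E(r_1,\dots,r_m)$ this construction can be carried out, its result $\widetilde Q$ does not depend on the choices made, and $\widetilde Q\in\mathcal E(r_1,\dots,r_m)$; so it defines a map $\mathscr R:\mathcal E(r_1,\dots,r_m)\to\mathcal E(r_1,\dots,r_m)$, $\mathscr R(\widetilde P)=\widetilde Q$. The map $\mathscr R$ is one-to-one, and it is onto, hence a bijection. Moreover, for every $\widetilde P\in\mathcal E(r_1,\dots,r_m)$ the optimal POVM $\mathscr P(\widetilde P)$ is unique, belongs to $\mathcal P(r_1,\dots,r_m)$, and $\mathscr P(\widetilde P)=PGM(\mathscr R(\widetilde P))$. -/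

import Mathlib

open scoped ComplexOrder MatrixOrder

noncomputable section

namespace MED

/-- An ensemble `{p i, ρ i}` of `m` states on the Hilbert space `H`: strictly positive probabilities
`p i` summing to `1`, and density operators `ρ i` (positive operators of trace `1`). -/
@[ext]
structure Ensemble (m : ℕ) (H : Type*) [NormedAddCommGroup H] [InnerProductSpace ℂ H]
    [CompleteSpace H] where
  p : Fin m → ℝ
  ρ : Fin m → (H →L[ℂ] H)
  p_pos : ∀ i, 0 < p i
  sum_p : ∑ i, p i = 1
  ρ_nonneg : ∀ i, 0 ≤ ρ i
  trace_ρ : ∀ i, LinearMap.trace ℂ H (ρ i : H →ₗ[ℂ] H) = 1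

variable {m : ℕ} {H : Type*} [NormedAddCommGroup H] [InnerProductSpace ℂ H] [CompleteSpace H]

/-- `𝓔(r₁, …, r_m)`: the ensembles of linearly independent states whose `i`-th state has rank `r i`.
The support of a positive operator is its range; states are linearly independent when their
supports are linearly independent subspaces. -/
def LIEnsembles (H : Type*) [NormedAddCommGroup H] [InnerProductSpace ℂ H] [CompleteSpace H]
    (r : Fin m → ℕ) : Set (Ensemble m H) :=
  {P | (∀ i, Module.finrank ℂ (LinearMap.range (P.ρ i : H →ₗ[ℂ] H)) = r i) ∧
    iSupIndep fun i => LinearMap.range (P.ρ i : H →ₗ[ℂ] H)}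

/-- An `m`-element POVM on `H`. -/
def IsPOVM (E : Fin m → (H →L[ℂ] H)) : Prop :=
  (∀ i, 0 ≤ E i) ∧ ∑ i, E i = 1

/-- The average probability of success `∑ i, p i * Tr (ρ i * E i)`. -/
def successProb (P : Ensemble m H) (E : Fin m → (H →L[ℂ] H)) : ℝ :=
  ∑ i, P.p i * (LinearMap.trace ℂ H (P.ρ i * E i : H →L[ℂ] H).toLinearMap).re

/-- `E` is an optimal POVM for the minimum error discrimination of `P`: it maximizes the success
probability among all `m`-element POVMs. -/
def IsOptimalPOVM (P : Ensemble m H) (E : Fin m → (H →L[ℂ] H)) : Prop :=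
  IsPOVM E ∧ ∀ F : Fin m → (H →L[ℂ] H), IsPOVM F → successProb P F ≤ successProb P E

/-- `𝓟(r₁, …, r_m)`: the projective measurements whose `i`-th projector has rank `r i`. -/
def ProjMeasurements (H : Type*) [NormedAddCommGroup H] [InnerProductSpace ℂ H] [CompleteSpace H]
    (r : Fin m → ℕ) : Set (Fin m → (H →L[ℂ] H)) :=
  {E | IsPOVM E ∧ (∀ i, Module.finrank ℂ (LinearMap.range (E i : H →ₗ[ℂ] H)) = r i) ∧
    ∀ i j, E i * E j = if i = j then E i else 0}

/-- The average operator `∑ j, q j σ j` of an ensemble. -/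
def Ensemble.avg (Q : Ensemble m H) : H →L[ℂ] H :=
  ∑ j, (Q.p j : ℂ) • Q.ρ j

/-- The pretty good measurement of an ensemble. -/
def PGM (Q : Ensemble m H) (i : Fin m) : H →L[ℂ] H :=
  Q.avg ^ (-(1 / 2) : ℝ) * ((Q.p i : ℂ) • Q.ρ i) * Q.avg ^ (-(1 / 2) : ℝ)

/-- The vectors `χ i j = ∑ k, (X i) k j • ψ i k`, where `X i` is the `i`-th diagonal block of the
block matrix `Y`. -/
def chi {r : Fin m → ℕ} (Y : Matrix ((i : Fin m) × Fin (r i)) ((i : Fin m) × Fin (r i)) ℂ)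
    (ψ : (i : Fin m) × Fin (r i) → H) (i : Fin m) (j : Fin (r i)) : H :=
  ∑ k, Y.blockDiag' i k j • ψ ⟨i, k⟩

/-- The correspondence `P ⟶ Q` between ensembles. The `n × n` matrices are indexed by pairs of a
block index `i` and an intra-block index `j` in `Fin (r i)`. -/
def Corresponds (r : Fin m → ℕ) (P Q : Ensemble m H) : Prop :=
  ∃ (E : Fin m → (H →L[ℂ] H)) (ψ u w : (i : Fin m) × Fin (r i) → H)
    (W Y : Matrix ((i : Fin m) × Fin (r i)) ((i : Fin m) × Fin (r i)) ℂ),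
    -- `E` is the optimal POVM of `P`
    IsOptimalPOVM P E ∧
    -- `ψ` resolves the `p i ρ i` into unnormalized pure states; `u` is the dual system
    (∀ i, (P.p i : ℂ) • P.ρ i = ∑ j, InnerProductSpace.rankOne ℂ (ψ ⟨i, j⟩) (ψ ⟨i, j⟩)) ∧
    (∀ a b, inner ℂ (ψ a) (u b) = if a = b then 1 else 0) ∧
    -- `Y = G ^ (1/2) W` with `G` the Gram matrix of `ψ` and `W` unitary
    W ∈ Matrix.unitaryGroup ((i : Fin m) × Fin (r i)) ℂ ∧
    Y = CFC.sqrt (Matrix.gram ℂ ψ) * W ∧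
    -- the vectors `w` with coefficients `Y` in the system `u` decompose the `E i`
    (∀ b, w b = ∑ a, Y a b • u a) ∧
    (∀ i, E i = ∑ j, InnerProductSpace.rankOne ℂ (w ⟨i, j⟩) (w ⟨i, j⟩)) ∧
    -- the decomposition of `E` is chosen so that the diagonal blocks of `Y` are positive
    (∀ i, (Y.blockDiag' i).PosSemidef) ∧
    -- `Q` is the normalized ensemble built from the vectors `χ`
    (∀ i, Q.ρ i = ((1 / ∑ k, ‖chi Y ψ i k‖ ^ 2 : ℝ) : ℂ) •
      ∑ j, InnerProductSpace.rankOne ℂ (chi Y ψ i j) (chi Y ψ i j)) ∧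
    (∀ i, Q.p i = (∑ j, ‖chi Y ψ i j‖ ^ 2) / ∑ l, ∑ k, ‖chi Y ψ l k‖ ^ 2)

end MED

end

/-!
A POVM `E` is optimal exactly when some `Z` satisfies `A i ≤ Z` and `Z * E i = A i * E i`, where
`A i = p i • ρ i`. If the supports of the `A i` decompose the space, then `Z` is invertible and
counting ranks forces `E i` to be the orthogonal projection onto the kernel of `Z - A i`; so the
optimal POVM is unique and projective.

Writing `A i = ∑ j |ψ i j⟩⟨ψ i j|`, the vectors `χ i j` are the images under `A i` of the vectors
`w i j`, so `∑ j |χ i j⟩⟨χ i j| = A i * E i * A i = Z * E i * Z`. Hence the weighted states of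
`R P` are proportional to the `Z * E i * Z`, their sum is proportional to `Z ^ 2`, and the pretty
good measurement of `R P` is `E`. Conversely, an ensemble `Q` determines the `E i` as its pretty
good measurement and `Z`, up to a scalar, as the square root of its average state. Then `A i` must
be the only positive operator of rank at most that of `E i` which agrees with `Z` on the range of
`E i`: the Krein–von Neumann extension of `Z` restricted to that range. Being the least positive
extension it is at most `Z`, so the optimality conditions hold.
-/

noncomputable section

namespace MED

section LinearAlgebra

variable {K V ι : Type*} [DivisionRing K] [AddCommGroup V] [Module K V]

theorem iSupIndep_and_finrank_eq_of_iSup_eq_top [FiniteDimensional K V] [Finite ι]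
    {U W : ι → Submodule K V} (hU : iSupIndep U) (hW : ⨆ i, W i = ⊤)
    (hle : ∀ i, Module.finrank K (W i) ≤ Module.finrank K (U i)) :
    iSupIndep W ∧ ∀ i, Module.finrank K (W i) = Module.finrank K (U i) := by
  classical
  cases nonempty_fintype ι
  have hdim (S : ι → Submodule K V) :
      Module.finrank K (Π₀ i, S i) = ∑ i, Module.finrank K (S i) :=
    Module.finrank_directSum K fun i => S i
  have hinj : Function.Injective (DFinsupp.lsum ℕ fun i => (U i).subtype) :=
    (iSupIndep_iff_dfinsupp_lsum_injective U).1 hU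
  have hsurj : Function.Surjective (DFinsupp.lsum ℕ fun i => (W i).subtype) := by
    rw [← LinearMap.range_eq_top, ← Submodule.iSup_eq_range_dfinsupp_lsum, hW]
  have hUV : ∑ i, Module.finrank K (U i) ≤ Module.finrank K V :=
    hdim U ▸ LinearMap.finrank_le_finrank_of_injective hinj
  have hVW : Module.finrank K V ≤ ∑ i, Module.finrank K (W i) :=
    hdim W ▸ LinearMap.finrank_le_finrank_of_surjective hsurj
  have hWU := Finset.sum_le_sum fun i (_ : i ∈ Finset.univ) => hle i
  constructor
  · rw [iSupIndep_iff_dfinsupp_lsum_injective]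
    refine (LinearMap.injective_iff_surjective_of_finrank_eq_finrank ?_).2 hsurj
    rw [hdim]
    exact le_antisymm (hWU.trans hUV) hVW
  · exact fun i => (Finset.sum_eq_sum_iff_of_le fun i _ => hle i).1
      (le_antisymm hWU (hUV.trans hVW)) i (Finset.mem_univ i)

theorem iSup_eq_top_of_iSupIndep_of_sum_finrank_eq [FiniteDimensional K V] [Fintype ι]
    {U : ι → Submodule K V} (hU : iSupIndep U)
    (hdim : ∑ i, Module.finrank K (U i) = Module.finrank K V) : ⨆ i, U i = ⊤ := by
  classical
  rw [Submodule.iSup_eq_range_dfinsupp_lsum, LinearMap.range_eq_top]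
  refine (LinearMap.injective_iff_surjective_of_finrank_eq_finrank ?_).1
    ((iSupIndep_iff_dfinsupp_lsum_injective U).1 hU)
  rw [← hdim]
  exact Module.finrank_directSum K fun i => U i

theorem finrank_range_mul_le_left [FiniteDimensional K V] (f g : Module.End K V) :
    Module.finrank K (LinearMap.range (f * g)) ≤ Module.finrank K (LinearMap.range f) :=
  Submodule.finrank_mono (LinearMap.range_comp_le_range g f)

theorem finrank_range_mul_le_right [FiniteDimensional K V] (f g : Module.End K V) :
    Module.finrank K (LinearMap.range (f * g)) ≤ Module.finrank K (LinearMap.range g) := by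
  rw [Module.End.mul_eq_comp, LinearMap.range_comp]
  exact Submodule.finrank_map_le f _

theorem iSup_range_eq_top_of_isUnit_sum_mul [Fintype ι] {f g : ι → Module.End K V}
    (h : IsUnit (∑ i, f i * g i)) : ⨆ i, LinearMap.range (f i) = ⊤ := by
  refine eq_top_iff.2 fun x _ => ?_
  obtain ⟨y, rfl⟩ := ((Module.End.isUnit_iff _).1 h).surjective x
  rw [LinearMap.sum_apply]
  exact Submodule.sum_mem _ fun i _ =>
    Submodule.mem_iSup_of_mem i (LinearMap.mem_range_self (f i) (g i y))

theorem mul_eq_ite_of_sum_eq_one [Fintype ι] [DecidableEq ι] {f : ι → Module.End K V}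
    (hsum : ∑ i, f i = 1) (hind : iSupIndep fun i => LinearMap.range (f i)) (i j : ι) :
    f i * f j = if i = j then f i else 0 := by
  ext x
  -- Both sides are the `i`-th component of `f j x`.
  have hcomp : ∑ k, f k (f j x) = ∑ k, (Pi.single j (f j x) : ι → V) k := by
    rw [Finset.sum_pi_single', if_pos (Finset.mem_univ j), ← LinearMap.sum_apply, hsum]
    rfl
  have hsingle : ∀ k, (Pi.single j (f j x) : ι → V) k ∈ LinearMap.range (f k) := fun k => by
    rcases eq_or_ne k j with rfl | hk <;> simp [*]
  have hi := (iSupIndep_iff_finsetSum_eq_imp_eq _).1 hind Finset.univ _ _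
    (fun k _ => ⟨LinearMap.mem_range_self (f k) _, hsingle k⟩) hcomp i (Finset.mem_univ i)
  rw [Module.End.mul_apply, hi]
  split_ifs with h
  · simp [h]
  · simp [Pi.single_eq_of_ne h]

end LinearAlgebra

section StarProjection

variable {𝕜 E : Type*} [RCLike 𝕜] [NormedAddCommGroup E] [InnerProductSpace 𝕜 E] [CompleteSpace E]

theorem eq_starProjection_of_finrank_range_le [FiniteDimensional 𝕜 E] {K : Submodule 𝕜 E}
    {B : E →L[𝕜] E} (hB : IsSelfAdjoint B) (hid : ∀ x ∈ K, B x = x)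
    (hrank : Module.finrank 𝕜 (LinearMap.range B.toLinearMap) ≤ Module.finrank 𝕜 K) :
    B = K.starProjection := by
  have hle : K ≤ LinearMap.range B.toLinearMap := fun x hx => ⟨x, hid x hx⟩
  have hrange : LinearMap.range B.toLinearMap = K :=
    (Submodule.eq_of_le_of_finrank_le hle hrank).symm
  ext x
  have hmem : B x ∈ K := hrange ▸ LinearMap.mem_range_self B.toLinearMap x
  refine (Submodule.eq_starProjection_of_mem_of_inner_eq_zero hmem fun y hy => ?_).symm
  have hsymm : inner 𝕜 (B x) y = inner 𝕜 x (B y) := hB.isSymmetric x y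
  rw [inner_sub_left, hsymm, hid y hy, sub_self]

end StarProjection

section Trace

variable {H : Type*} [NormedAddCommGroup H] [InnerProductSpace ℂ H]

/-- The real part of the trace, as a real-linear functional on the bounded operators. -/
def reTr : (H →L[ℂ] H) →ₗ[ℝ] ℝ :=
  Complex.reLm ∘ₗ (LinearMap.trace ℂ H ∘ₗ ContinuousLinearMap.coeLM ℂ).restrictScalars ℝ

theorem reTr_apply (A : H →L[ℂ] H) : reTr A = (LinearMap.trace ℂ H A.toLinearMap).re := rfl

theorem reTr_mul_comm (A B : H →L[ℂ] H) : reTr (A * B) = reTr (B * A) :=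
  congrArg Complex.re (LinearMap.trace_mul_comm ℂ A.toLinearMap B.toLinearMap)

theorem trace_eq_reTr {A : H →L[ℂ] H} (hA : 0 ≤ A) :
    LinearMap.trace ℂ H A.toLinearMap = reTr A :=
  Complex.eq_re_of_ofReal_le (r := 0) <| by
    simpa using ((ContinuousLinearMap.nonneg_iff_isPositive A).1 hA).toLinearMap.trace_nonneg

theorem reTr_nonneg {A : H →L[ℂ] H} (hA : 0 ≤ A) : 0 ≤ reTr A :=
  (Complex.le_def.1 ((ContinuousLinearMap.nonneg_iff_isPositive A).1 hA).toLinearMap.trace_nonneg).1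

theorem reTr_mul_eq_reTr_star_mul_self [CompleteSpace H] {A B : H →L[ℂ] H} (hA : 0 ≤ A)
    (hB : 0 ≤ B) :
    reTr (A * B) = reTr (star (CFC.sqrt A * CFC.sqrt B) * (CFC.sqrt A * CFC.sqrt B)) := by
  have hsA : star (CFC.sqrt A) = CFC.sqrt A := (CFC.sqrt_nonneg A).isSelfAdjoint
  have hsB : star (CFC.sqrt B) = CFC.sqrt B := (CFC.sqrt_nonneg B).isSelfAdjoint
  calc reTr (A * B)
    _ = reTr (CFC.sqrt A * CFC.sqrt A * CFC.sqrt B * CFC.sqrt B) := by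
        rw [mul_assoc, CFC.sqrt_mul_sqrt_self A hA, CFC.sqrt_mul_sqrt_self B hB]
    _ = reTr (CFC.sqrt B * (CFC.sqrt A * CFC.sqrt A * CFC.sqrt B)) := reTr_mul_comm _ _
    _ = _ := by rw [star_mul, hsA, hsB]; simp only [mul_assoc]

variable [FiniteDimensional ℂ H]

theorem reTr_rankOne_self (x : H) : reTr (InnerProductSpace.rankOne ℂ x x) = ‖x‖ ^ 2 := by
  rw [reTr_apply, InnerProductSpace.trace_rankOne, inner_self_eq_norm_sq_to_K]
  norm_cast

theorem reTr_sum_rankOne_self {ι : Type*} [Fintype ι] (v : ι → H) :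
    reTr (∑ j, InnerProductSpace.rankOne ℂ (v j) (v j)) = ∑ j, ‖v j‖ ^ 2 := by
  simp only [map_sum, reTr_rankOne_self]

theorem reTr_mul_rankOne_self (A : H →L[ℂ] H) (x : H) :
    reTr (A * InnerProductSpace.rankOne ℂ x x) = (inner ℂ x (A x)).re := by
  have hcomp : A * InnerProductSpace.rankOne ℂ x x = InnerProductSpace.rankOne ℂ (A x) x :=
    InnerProductSpace.comp_rankOne x x A
  rw [hcomp, reTr_apply, InnerProductSpace.trace_rankOne]

variable [CompleteSpace H]

theorem reTr_star_mul_self (A : H →L[ℂ] H) :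
    reTr (star A * A) = ∑ i, ‖A (stdOrthonormalBasis ℂ H i)‖ ^ 2 := by
  rw [reTr_apply, LinearMap.trace_eq_sum_inner _ (stdOrthonormalBasis ℂ H), Complex.re_sum]
  exact Finset.sum_congr rfl fun i _ =>
    (ContinuousLinearMap.apply_norm_sq_eq_inner_adjoint_right A _).symm

theorem reTr_star_mul_self_nonneg (A : H →L[ℂ] H) : 0 ≤ reTr (star A * A) := by
  rw [reTr_star_mul_self]
  positivity

theorem eq_zero_of_reTr_star_mul_self_eq_zero {A : H →L[ℂ] H} (h : reTr (star A * A) = 0) :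
    A = 0 := by
  rw [reTr_star_mul_self, Finset.sum_eq_zero_iff_of_nonneg fun _ _ => by positivity] at h
  refine ContinuousLinearMap.coe_injective ((stdOrthonormalBasis ℂ H).toBasis.ext fun i => ?_)
  simpa using h i (Finset.mem_univ i)

theorem reTr_mul_nonneg {A B : H →L[ℂ] H} (hA : 0 ≤ A) (hB : 0 ≤ B) : 0 ≤ reTr (A * B) :=
  reTr_mul_eq_reTr_star_mul_self hA hB ▸ reTr_star_mul_self_nonneg _

theorem mul_eq_zero_of_reTr_mul_eq_zero {A B : H →L[ℂ] H} (hA : 0 ≤ A) (hB : 0 ≤ B)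
    (h : reTr (A * B) = 0) : A * B = 0 := by
  have hsqrt : CFC.sqrt A * CFC.sqrt B = 0 :=
    eq_zero_of_reTr_star_mul_self_eq_zero (reTr_mul_eq_reTr_star_mul_self hA hB ▸ h)
  calc A * B = CFC.sqrt A * (CFC.sqrt A * CFC.sqrt B) * CFC.sqrt B := by
        rw [← mul_assoc, mul_assoc, CFC.sqrt_mul_sqrt_self A hA, CFC.sqrt_mul_sqrt_self B hB]
    _ = 0 := by rw [hsqrt, mul_zero, zero_mul]

theorem eq_zero_of_reTr_eq_zero {A : H →L[ℂ] H} (hA : 0 ≤ A) (h : reTr A = 0) : A = 0 := by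
  simpa using mul_eq_zero_of_reTr_mul_eq_zero hA zero_le_one (by simpa using h)

end Trace

section Order

variable {H : Type*} [NormedAddCommGroup H] [InnerProductSpace ℂ H] [CompleteSpace H]

theorem inner_apply_self_eq_norm_sqrt_sq {A : H →L[ℂ] H} (hA : 0 ≤ A) (x : H) :
    inner ℂ (A x) x = (‖CFC.sqrt A x‖ ^ 2 : ℝ) := by
  have hsymm := (CFC.sqrt_nonneg A).isSelfAdjoint.isSymmetric (CFC.sqrt A x) x
  rw [ContinuousLinearMap.coe_coe] at hsymm
  nth_rw 1 [← CFC.sqrt_mul_sqrt_self A hA]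
  rw [mul_apply_eq_comp, hsymm, inner_self_eq_norm_sq_to_K]
  norm_cast

theorem ker_le_ker_of_le {A Z : H →L[ℂ] H} (hA : 0 ≤ A) (hle : A ≤ Z) :
    LinearMap.ker Z.toLinearMap ≤ LinearMap.ker A.toLinearMap := by
  intro x (hx : Z x = 0)
  have hZA := ((ContinuousLinearMap.nonneg_iff_isPositive _).1 (sub_nonneg.2 hle))
    |>.re_inner_nonneg_left x
  rw [_root_.sub_apply, hx, zero_sub, inner_neg_left, inner_apply_self_eq_norm_sqrt_sq hA,
    map_neg, RCLike.re_to_complex, Complex.ofReal_re] at hZA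
  have h0 : CFC.sqrt A x = 0 := norm_eq_zero.1 (by nlinarith [sq_nonneg ‖CFC.sqrt A x‖])
  change A x = 0
  rw [← CFC.sqrt_mul_sqrt_self A hA, mul_apply_eq_comp, h0, map_zero]

theorem isUnit_of_iSup_range_eq_top [FiniteDimensional ℂ H] {ι : Type*} {A : ι → (H →L[ℂ] H)}
    {Z : H →L[ℂ] H} (hA : ∀ i, 0 ≤ A i) (htop : ⨆ i, LinearMap.range (A i).toLinearMap = ⊤)
    (hle : ∀ i, A i ≤ Z) : IsUnit Z := by
  have hker : LinearMap.ker Z.toLinearMap = ⊥ := by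
    rw [eq_bot_iff, ← Submodule.top_orthogonal_eq_bot, ← htop, ← Submodule.iInf_orthogonal]
    refine le_iInf fun i => (ker_le_ker_of_le (hA i) (hle i)).trans_eq ?_
    have hadj : ContinuousLinearMap.adjoint (A i) = A i := (hA i).isSelfAdjoint
    rw [(A i).orthogonal_range, hadj]
  have hinj := LinearMap.ker_eq_bot.1 hker
  exact ContinuousLinearMap.isUnit_iff_bijective.2 ⟨hinj, LinearMap.injective_iff_surjective.1 hinj⟩

end Order

section MinimalExtension

variable {H : Type*} [NormedAddCommGroup H] [InnerProductSpace ℂ H] [CompleteSpace H]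
  [FiniteDimensional ℂ H]

/-- The Krein–von Neumann extension of `Z` restricted to `L`: the least positive operator that
agrees with the positive operator `Z` on the subspace `L`. -/
def minimalExtension (Z : H →L[ℂ] H) (L : Submodule ℂ H) : H →L[ℂ] H :=
  CFC.sqrt Z * (L.map (CFC.sqrt Z).toLinearMap).starProjection * CFC.sqrt Z

variable {Z : H →L[ℂ] H}

theorem minimalExtension_nonneg (Z : H →L[ℂ] H) (L : Submodule ℂ H) :
    0 ≤ minimalExtension Z L := by
  have h := star_left_conjugate_nonneg
    (isStarProjection_starProjection (U := L.map (CFC.sqrt Z).toLinearMap)).nonneg (CFC.sqrt Z)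
  rwa [(CFC.sqrt_nonneg Z).isSelfAdjoint.star_eq] at h

theorem minimalExtension_le (hZ : 0 ≤ Z) (L : Submodule ℂ H) : minimalExtension Z L ≤ Z := by
  have h := star_left_conjugate_le_conjugate
    (isStarProjection_starProjection (U := L.map (CFC.sqrt Z).toLinearMap)).le_one (CFC.sqrt Z)
  rwa [(CFC.sqrt_nonneg Z).isSelfAdjoint.star_eq, mul_one, CFC.sqrt_mul_sqrt_self Z hZ] at h

theorem minimalExtension_apply_of_mem (hZ : 0 ≤ Z) {L : Submodule ℂ H} {x : H} (hx : x ∈ L) :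
    minimalExtension Z L x = Z x := by
  have hmem := Submodule.mem_map_of_mem (f := (CFC.sqrt Z).toLinearMap) hx
  have hproj := Submodule.starProjection_eq_self_iff.2 hmem
  rw [ContinuousLinearMap.coe_coe] at hproj
  rw [minimalExtension, mul_apply_eq_comp, mul_apply_eq_comp, hproj, ← mul_apply_eq_comp,
    CFC.sqrt_mul_sqrt_self Z hZ]

theorem finrank_range_minimalExtension_le (Z : H →L[ℂ] H) (L : Submodule ℂ H) :
    Module.finrank ℂ (LinearMap.range (minimalExtension Z L).toLinearMap) ≤
      Module.finrank ℂ L := by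
  let P := (L.map (CFC.sqrt Z).toLinearMap).starProjection
  calc Module.finrank ℂ (LinearMap.range (minimalExtension Z L).toLinearMap)
    _ ≤ Module.finrank ℂ (LinearMap.range (CFC.sqrt Z * P).toLinearMap) :=
        finrank_range_mul_le_left (CFC.sqrt Z * P).toLinearMap (CFC.sqrt Z).toLinearMap
    _ ≤ Module.finrank ℂ (LinearMap.range P.toLinearMap) :=
        finrank_range_mul_le_right (CFC.sqrt Z).toLinearMap P.toLinearMap
    _ = Module.finrank ℂ (L.map (CFC.sqrt Z).toLinearMap) := by
        rw [Submodule.range_starProjection]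
    _ ≤ Module.finrank ℂ L := Submodule.finrank_map_le _ L

theorem eq_minimalExtension (hZ : 0 ≤ Z) (hZu : IsUnit Z) {A : H →L[ℂ] H} (hA : IsSelfAdjoint A)
    {L : Submodule ℂ H} (hAL : ∀ x ∈ L, A x = Z x)
    (hrank : Module.finrank ℂ (LinearMap.range A.toLinearMap) ≤ Module.finrank ℂ L) :
    A = minimalExtension Z L := by
  set T := CFC.sqrt Z with hT
  have hTT : T * T = Z := CFC.sqrt_mul_sqrt_self Z hZ
  have hTsa : IsSelfAdjoint T := (CFC.sqrt_nonneg Z).isSelfAdjoint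
  have hTu : IsUnit T := (CFC.isUnit_sqrt_iff Z hZ).2 hZu
  obtain ⟨S, hTS, hST⟩ := isUnit_iff_exists.1 hTu
  have hSsa : IsSelfAdjoint S := by
    have hstar : star S * T = 1 := by
      simpa only [star_mul, hTsa.star_eq, star_one] using congrArg star hTS
    exact left_inv_eq_right_inv hstar hTS
  have hB : IsSelfAdjoint (S * A * S) := by
    simpa only [hSsa.star_eq] using hA.conjugate S
  have hBT : ∀ y ∈ L.map T.toLinearMap, (S * A * S) y = y := by
    rintro _ ⟨x, hx, rfl⟩
    have hSZ : S * Z = T := by rw [← hTT, ← mul_assoc, hST, one_mul]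
    calc (S * A * S) (T x) = S (A ((S * T) x)) := rfl
      _ = (S * Z) x := by rw [hST, one_apply_eq_self, hAL x hx, mul_apply_eq_comp]
      _ = T x := by rw [hSZ]
  have hproj : S * A * S = (L.map T.toLinearMap).starProjection := by
    refine eq_starProjection_of_finrank_range_le hB hBT ?_
    have hTinj : Function.Injective T.toLinearMap :=
      (ContinuousLinearMap.isUnit_iff_bijective.1 hTu).1
    rw [← (Submodule.equivMapOfInjective T.toLinearMap hTinj L).finrank_eq]
    exact (finrank_range_mul_le_left (S * A).toLinearMap S.toLinearMap).trans
      ((finrank_range_mul_le_right S.toLinearMap A.toLinearMap).trans hrank)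
  calc A = T * S * A * (S * T) := by rw [hTS, hST, one_mul, mul_one]
    _ = T * (S * A * S) * T := by simp only [mul_assoc]
    _ = minimalExtension Z L := by rw [hproj, minimalExtension, hT]

end MinimalExtension

section Ensemble

variable {m : ℕ} {H : Type*} [NormedAddCommGroup H] [InnerProductSpace ℂ H] [CompleteSpace H]

namespace Ensemble

/-- The weighted states `p i ρ i` of an ensemble, which determine it. -/
def weighted (P : Ensemble m H) (i : Fin m) : H →L[ℂ] H := (P.p i : ℂ) • P.ρ i

theorem nonempty (P : Ensemble m H) : Nonempty (Fin m) := by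
  by_contra h
  rw [not_nonempty_iff] at h
  simpa using P.sum_p

variable (P : Ensemble m H) (i : Fin m)

theorem weighted_eq_smul : P.weighted i = P.p i • P.ρ i := Complex.coe_smul _ _

theorem weighted_nonneg : 0 ≤ P.weighted i :=
  P.weighted_eq_smul i ▸ smul_nonneg (P.p_pos i).le (P.ρ_nonneg i)

theorem avg_eq_sum_weighted : P.avg = ∑ j, P.weighted j := rfl

theorem avg_nonneg : 0 ≤ P.avg := Finset.sum_nonneg fun i _ => P.weighted_nonneg i

theorem reTr_ρ : reTr (P.ρ i) = 1 := by
  rw [reTr_apply, P.trace_ρ, Complex.one_re]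

theorem reTr_weighted : reTr (P.weighted i) = P.p i := by
  rw [weighted_eq_smul, map_smul, reTr_ρ, smul_eq_mul, mul_one]

theorem range_weighted :
    LinearMap.range (P.weighted i).toLinearMap = LinearMap.range (P.ρ i).toLinearMap :=
  LinearMap.range_smul _ _ (Complex.ofReal_ne_zero.2 (P.p_pos i).ne')

variable {P} {Q : Ensemble m H}

theorem eq_of_weighted_eq_smul {c : ℝ} (h : ∀ i, P.weighted i = c • Q.weighted i) : P = Q := by
  have hp (i : Fin m) : P.p i = c * Q.p i := by
    rw [← reTr_weighted, h, map_smul, reTr_weighted, smul_eq_mul]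
  have hc : c = 1 := by
    rw [← P.sum_p, Finset.sum_congr rfl fun i _ => hp i, ← Finset.mul_sum, Q.sum_p, mul_one]
  have hpp : P.p = Q.p := funext fun i => by rw [hp, hc, one_mul]
  refine Ensemble.ext hpp (funext fun i => smul_right_injective _ (Q.p_pos i).ne' ?_)
  simpa only [weighted_eq_smul, hc, hpp, one_smul] using h i

end Ensemble

theorem successProb_eq_sum_reTr (P : Ensemble m H) (E : Fin m → (H →L[ℂ] H)) :
    successProb P E = ∑ i, reTr (P.weighted i * E i) := by
  refine Finset.sum_congr rfl fun i _ => ?_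
  rw [P.weighted_eq_smul, smul_mul_assoc, map_smul, smul_eq_mul, reTr_apply]

end Ensemble

section FirstOrder

theorem nonpos_of_eventually_linear_add_sq_nonpos {a d : ℝ}
    (h : ∀ᶠ ε in nhdsWithin (0 : ℝ) (Set.Ioi 0), ε * a + ε ^ 2 * d ≤ 0) : a ≤ 0 := by
  have hlim : Filter.Tendsto (fun ε : ℝ => a + ε * d) (nhdsWithin 0 (Set.Ioi 0)) (nhds a) := by
    have hcont : Continuous fun ε : ℝ => a + ε * d := by fun_prop
    simpa using (hcont.tendsto 0).mono_left nhdsWithin_le_nhds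
  refine le_of_tendsto hlim ?_
  filter_upwards [h, self_mem_nhdsWithin] with ε hε (hpos : 0 < ε)
  nlinarith

theorem reTr_mul_one_sub_smul_conj {H : Type*} [NormedAddCommGroup H] [InnerProductSpace ℂ H]
    (A E K : H →L[ℂ] H) (ε : ℝ) :
    reTr (A * ((1 - ε • K) * E * (1 - ε • K))) =
      reTr (A * E) - ε * reTr ((A * E + E * A) * K) + ε ^ 2 * reTr (A * (K * E * K)) := by
  have hexpand : A * ((1 - ε • K) * E * (1 - ε • K)) =
      A * E - ε • (A * E * K) - ε • (A * K * E) + ε ^ 2 • (A * (K * E * K)) := by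
    simp only [mul_sub, sub_mul, one_mul, mul_one, smul_mul_assoc, mul_smul_comm, mul_assoc]
    module
  have hcycle : reTr (A * K * E) = reTr (E * A * K) := by rw [reTr_mul_comm, mul_assoc]
  rw [hexpand]
  simp only [map_add, map_sub, map_smul, smul_eq_mul, add_mul, hcycle]
  ring

end FirstOrder

section Optimality

variable {m : ℕ} {H : Type*} [NormedAddCommGroup H] [InnerProductSpace ℂ H]
  {A E F : Fin m → (H →L[ℂ] H)} {Z : H →L[ℂ] H}

/-- The Karush–Kuhn–Tucker conditions for maximizing `∑ i, Tr (A i * E i)` over all POVMs `E`: the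
Lagrange multiplier `Z` dominates every `A i`, with complementary slackness. -/
structure IsOptimalWith (A E : Fin m → (H →L[ℂ] H)) (Z : H →L[ℂ] H) : Prop where
  povm : IsPOVM E
  le : ∀ i, A i ≤ Z
  mul_eq : ∀ i, Z * E i = A i * E i

/-- The only possible multiplier for an optimal POVM `E` is `∑ i, A i * E i`. It is symmetrized here
because that sum is not known to be self-adjoint before optimality has been exploited. -/
def symmMultiplier (A E : Fin m → (H →L[ℂ] H)) : H →L[ℂ] H :=
  (1 / 2 : ℝ) • ∑ i, (A i * E i + E i * A i)

theorem sum_reTr_mul_one_sub_smul_conj_add_single (A E : Fin m → (H →L[ℂ] H)) (K D : H →L[ℂ] H)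
    (ε : ℝ) (j : Fin m) :
    ∑ i, reTr (A i *
        ((1 - ε • K) * E i * (1 - ε • K) + (Pi.single j D : Fin m → (H →L[ℂ] H)) i)) =
      ∑ i, reTr (A i * E i) - ε * (2 * reTr (symmMultiplier A E * K)) +
        ε ^ 2 * ∑ i, reTr (A i * (K * E i * K)) + reTr (A j * D) := by
  have hsingle : ∑ i, reTr (A i * (Pi.single j D : Fin m → (H →L[ℂ] H)) i) = reTr (A j * D) := by
    rw [Finset.sum_eq_single_of_mem j (Finset.mem_univ j), Pi.single_eq_same]
    intro i _ hij
    rw [Pi.single_eq_of_ne hij, mul_zero, map_zero]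
  have hsymm : 2 * reTr (symmMultiplier A E * K) =
      ∑ i, reTr ((A i * E i + E i * A i) * K) := by
    rw [symmMultiplier, smul_mul_assoc, map_smul, Finset.sum_mul, map_sum, smul_eq_mul]
    ring
  simp only [mul_add, map_add, reTr_mul_one_sub_smul_conj, Finset.sum_add_distrib,
    Finset.sum_sub_distrib, ← Finset.mul_sum, hsingle, hsymm]

theorem IsPOVM.sum_reTr_mul (hE : IsPOVM E) (Z : H →L[ℂ] H) : ∑ i, reTr (Z * E i) = reTr Z := by
  rw [← map_sum, ← Finset.mul_sum, hE.2, mul_one]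

namespace IsOptimalWith

theorem multiplier_eq_sum (h : IsOptimalWith A E Z) : Z = ∑ i, A i * E i := by
  rw [← Finset.sum_congr rfl fun i _ => h.mul_eq i, ← Finset.mul_sum, h.povm.2, mul_one]

theorem multiplier_nonneg (hA : ∀ i, 0 ≤ A i) (h : IsOptimalWith A E Z) : 0 ≤ Z := by
  rcases isEmpty_or_nonempty (Fin m) with _ | ⟨⟨i⟩⟩
  · rw [h.multiplier_eq_sum, Finset.univ_eq_empty, Finset.sum_empty]
  · exact (hA i).trans (h.le i)

variable [CompleteSpace H]

theorem smul {c : ℝ} (hc : 0 ≤ c) (h : IsOptimalWith A E Z) :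
    IsOptimalWith (c • A) E (c • Z) where
  povm := h.povm
  le i := smul_le_smul_of_nonneg_left (h.le i) hc
  mul_eq i := by rw [Pi.smul_apply, smul_mul_assoc, smul_mul_assoc, h.mul_eq]

end IsOptimalWith

variable [CompleteSpace H]

theorem IsPOVM.compress (hE : IsPOVM E) {T : H →L[ℂ] H} (hT : star T * T ≤ 1) (j : Fin m) :
    IsPOVM fun i => star T * E i * T + (Pi.single j (1 - star T * T) : Fin m → (H →L[ℂ] H)) i := by
  constructor
  · intro i
    refine add_nonneg (star_left_conjugate_nonneg (hE.1 i) T) ?_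
    rcases eq_or_ne i j with rfl | hij
    · simpa using hT
    · simp [Pi.single_eq_of_ne hij]
  · rw [Finset.sum_add_distrib, ← Finset.sum_mul, ← Finset.mul_sum, hE.2, mul_one,
      Finset.sum_pi_single', if_pos (Finset.mem_univ j), add_sub_cancel]

theorem reTr_mul_rankOne_le_of_isMax (hE : IsPOVM E)
    (hmax : ∀ F, IsPOVM F → ∑ i, reTr (A i * F i) ≤ ∑ i, reTr (A i * E i)) (j : Fin m) (v : H) :
    reTr (A j * InnerProductSpace.rankOne ℂ v v) ≤
      reTr (symmMultiplier A E * InnerProductSpace.rankOne ℂ v v) := by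
  set K := InnerProductSpace.rankOne ℂ v v
  have hK : 0 ≤ K := (ContinuousLinearMap.nonneg_iff_isPositive K).2
    (InnerProductSpace.isPositive_rankOne_self v)
  have hKK : K * K = ‖v‖ ^ 2 • K := by
    rw [← Complex.coe_smul, Complex.ofReal_pow]
    exact (InnerProductSpace.rankOne_comp_rankOne v v v v).trans
      (by rw [inner_self_eq_norm_sq_to_K]; rfl)
  have hadj (ε : ℝ) : star (1 - ε • K) = 1 - ε • K := by
    rw [star_sub, star_one, star_smul, hK.isSelfAdjoint.star_eq, star_trivial]
  have hdefect (ε : ℝ) : 1 - (1 - ε • K) * (1 - ε • K) = (ε * (2 - ε * ‖v‖ ^ 2)) • K := by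
    simp only [mul_sub, sub_mul, one_mul, mul_one, smul_mul_smul_comm, hKK]
    module
  -- For small `ε > 0`, compressing `E` by `1 - ε K` and giving the defect to outcome `j` is a POVM.
  have hfirst : ∀ᶠ ε in nhdsWithin (0 : ℝ) (Set.Ioi 0),
      ε * (2 * (reTr (A j * K) - reTr (symmMultiplier A E * K))) +
        ε ^ 2 * (∑ i, reTr (A i * (K * E i * K)) - ‖v‖ ^ 2 * reTr (A j * K)) ≤ 0 := by
    have hcont : Continuous fun ε : ℝ => ε * ‖v‖ ^ 2 := by fun_prop
    have hsmall : ∀ᶠ ε in nhdsWithin (0 : ℝ) (Set.Ioi 0), ε * ‖v‖ ^ 2 < 2 :=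
      nhdsWithin_le_nhds ((hcont.tendsto 0).eventually_lt_const (by simp))
    filter_upwards [hsmall, self_mem_nhdsWithin] with ε hε (hpos : 0 < ε)
    have hT : star (1 - ε • K) * (1 - ε • K) ≤ 1 := by
      rw [hadj, ← sub_nonneg, hdefect]
      exact smul_nonneg (mul_nonneg hpos.le (sub_nonneg.2 hε.le)) hK
    have hval := hmax _ (hE.compress hT j)
    simp only [hadj, hdefect, sum_reTr_mul_one_sub_smul_conj_add_single, mul_smul_comm, map_smul,
      smul_eq_mul] at hval
    linarith
  linarith [nonpos_of_eventually_linear_add_sq_nonpos hfirst]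

variable [FiniteDimensional ℂ H]

theorem IsOptimalWith.sum_reTr_le (h : IsOptimalWith A E Z) (hF : IsPOVM F) :
    ∑ i, reTr (A i * F i) ≤ ∑ i, reTr (A i * E i) := by
  calc ∑ i, reTr (A i * F i)
    _ ≤ ∑ i, reTr (Z * F i) := Finset.sum_le_sum fun i _ => by
        rw [← sub_nonneg, ← map_sub, ← sub_mul]
        exact reTr_mul_nonneg (sub_nonneg.2 (h.le i)) (hF.1 i)
    _ = ∑ i, reTr (Z * E i) := by rw [hF.sum_reTr_mul, h.povm.sum_reTr_mul]
    _ = ∑ i, reTr (A i * E i) := by simp only [h.mul_eq]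

theorem IsOptimalWith.of_reTr_le (hle : ∀ i, A i ≤ Z) (hF : IsPOVM F)
    (hZ : reTr Z ≤ ∑ i, reTr (A i * F i)) : IsOptimalWith A F Z := by
  have hnonneg : ∀ i ∈ Finset.univ, 0 ≤ reTr ((Z - A i) * F i) := fun i _ =>
    reTr_mul_nonneg (sub_nonneg.2 (hle i)) (hF.1 i)
  have hsum : ∑ i, reTr ((Z - A i) * F i) = 0 := by
    refine le_antisymm ?_ (Finset.sum_nonneg hnonneg)
    simp only [sub_mul, map_sub, Finset.sum_sub_distrib, hF.sum_reTr_mul]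
    linarith
  refine ⟨hF, hle, fun i => ?_⟩
  have hslack := mul_eq_zero_of_reTr_mul_eq_zero (sub_nonneg.2 (hle i)) (hF.1 i)
    ((Finset.sum_eq_zero_iff_of_nonneg hnonneg).1 hsum i (Finset.mem_univ i))
  rwa [sub_mul, sub_eq_zero] at hslack

theorem IsOptimalWith.of_isMax (h : IsOptimalWith A E Z) (hF : IsPOVM F)
    (hmax : ∑ i, reTr (A i * E i) ≤ ∑ i, reTr (A i * F i)) : IsOptimalWith A F Z := by
  refine .of_reTr_le h.le hF (le_of_eq_of_le ?_ hmax)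
  rw [← h.povm.sum_reTr_mul Z]
  simp only [h.mul_eq]

theorem nonneg_of_reTr_mul_rankOne_self_nonneg {B : H →L[ℂ] H} (hB : IsSelfAdjoint B)
    (h : ∀ v, 0 ≤ reTr (B * InnerProductSpace.rankOne ℂ v v)) : 0 ≤ B := by
  rw [ContinuousLinearMap.nonneg_iff_isPositive, ContinuousLinearMap.isPositive_def']
  refine ⟨hB, fun v => ?_⟩
  rw [ContinuousLinearMap.reApplyInnerSelf_apply, inner_re_symm]
  exact (h v).trans_eq (reTr_mul_rankOne_self B v)

theorem isOptimalWith_symmMultiplier (hA : ∀ i, 0 ≤ A i) (hE : IsPOVM E)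
    (hmax : ∀ F, IsPOVM F → ∑ i, reTr (A i * F i) ≤ ∑ i, reTr (A i * E i)) :
    IsOptimalWith A E (symmMultiplier A E) := by
  have hsa : IsSelfAdjoint (symmMultiplier A E) := by
    refine IsSelfAdjoint.smul (.all _) (isSelfAdjoint_sum _ fun i _ => ?_)
    rw [IsSelfAdjoint, star_add, star_mul, star_mul, (hA i).isSelfAdjoint.star_eq,
      (hE.1 i).isSelfAdjoint.star_eq, add_comm]
  refine .of_reTr_le (fun j => sub_nonneg.1 ?_) hE ?_
  · refine nonneg_of_reTr_mul_rankOne_self_nonneg (hsa.sub (hA j).isSelfAdjoint) fun v => ?_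
    rw [sub_mul, map_sub, sub_nonneg]
    exact reTr_mul_rankOne_le_of_isMax hE hmax j v
  · rw [symmMultiplier, map_smul, map_sum, smul_eq_mul, Finset.mul_sum]
    refine Finset.sum_le_sum fun i _ => ?_
    rw [map_add, reTr_mul_comm (E i)]
    linarith

theorem isOptimalPOVM_iff_exists_isOptimalWith {P : Ensemble m H} :
    IsOptimalPOVM P E ↔ ∃ Z, IsOptimalWith P.weighted E Z := by
  simp only [IsOptimalPOVM, successProb_eq_sum_reTr]
  exact ⟨fun ⟨hE, hmax⟩ => ⟨_, isOptimalWith_symmMultiplier P.weighted_nonneg hE hmax⟩,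
    fun ⟨_, hZ⟩ => ⟨hZ.povm, fun _ => hZ.sum_reTr_le⟩⟩

theorem isCompact_setOf_isPOVM : IsCompact {E : Fin m → (H →L[ℂ] H) | IsPOVM E} := by
  have : ProperSpace (H →L[ℂ] H) := FiniteDimensional.proper ℂ _
  refine Metric.isCompact_of_isClosed_isBounded
    (.inter (s₁ := {E : Fin m → (H →L[ℂ] H) | ∀ i, 0 ≤ E i}) (s₂ := {E | ∑ i, E i = 1}) ?_ ?_) ?_
  · rw [Set.ofPred_forall]
    exact isClosed_iInter fun i => isClosed_le continuous_const (continuous_apply i)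
  · exact isClosed_eq (continuous_finsetSum _ fun i _ => continuous_apply i) continuous_const
  · refine isBounded_iff_forall_norm_le.2 ⟨‖(1 : H →L[ℂ] H)‖, fun E hE => ?_⟩
    refine (pi_norm_le_iff_of_nonneg (norm_nonneg _)).2 fun i => ?_
    refine CStarAlgebra.norm_le_norm_of_nonneg_of_le (hE.1 i) ?_
    exact (Finset.single_le_sum (fun j _ => hE.1 j) (Finset.mem_univ i)).trans_eq hE.2

theorem exists_isOptimalPOVM (P : Ensemble m H) : ∃ E, IsOptimalPOVM P E := by
  have hne : {E : Fin m → (H →L[ℂ] H) | IsPOVM E}.Nonempty := by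
    obtain ⟨i⟩ := P.nonempty
    exact ⟨Pi.single i 1, Pi.single_nonneg.2 zero_le_one, by simp⟩
  have hcont : Continuous (successProb P) := by
    have hreTr : Continuous (reTr : (H →L[ℂ] H) →ₗ[ℝ] ℝ) :=
      LinearMap.continuous_of_finiteDimensional _
    simp only [funext (successProb_eq_sum_reTr P)]
    exact continuous_finsetSum _ fun i _ =>
      hreTr.comp (continuous_const.mul (continuous_apply i))
  obtain ⟨E, hE, hmax⟩ := isCompact_setOf_isPOVM.exists_isMaxOn hne hcont.continuousOn
  exact ⟨E, hE, fun F hF => hmax hF⟩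

end Optimality

section SupportDecomposition

variable {H : Type*} [NormedAddCommGroup H] [InnerProductSpace ℂ H]

/-- A family of positive operators whose supports decompose the space into a direct sum. It plays
the role of the weighted states of an ensemble of linearly independent states. -/
structure IsSupportDecomposition {ι : Type*} (A : ι → (H →L[ℂ] H)) : Prop where
  nonneg : ∀ i, 0 ≤ A i
  iSupIndep : iSupIndep fun i => LinearMap.range (A i).toLinearMap
  iSup_eq_top : ⨆ i, LinearMap.range (A i).toLinearMap = ⊤

variable {m : ℕ} {A E F : Fin m → (H →L[ℂ] H)} {Z : H →L[ℂ] H}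

theorem range_real_smul {c : ℝ} (hc : c ≠ 0) (A : H →L[ℂ] H) :
    LinearMap.range (c • A).toLinearMap = LinearMap.range A.toLinearMap := by
  rw [← Complex.coe_smul]
  exact LinearMap.range_smul _ _ (Complex.ofReal_ne_zero.2 hc)

theorem IsSupportDecomposition.smul [CompleteSpace H] (hA : IsSupportDecomposition A) {c : ℝ}
    (hc : 0 < c) : IsSupportDecomposition (c • A) := by
  have hrange (i : Fin m) :
      LinearMap.range ((c • A) i).toLinearMap = LinearMap.range (A i).toLinearMap :=
    range_real_smul hc.ne' (A i)
  refine ⟨fun i => smul_nonneg hc.le (hA.nonneg i), ?_, ?_⟩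
  · rw [funext hrange]
    exact hA.iSupIndep
  · rw [funext hrange]
    exact hA.iSup_eq_top

theorem IsPOVM.mul_eq_ite (hE : IsPOVM E) (hEd : IsSupportDecomposition E) (i j : Fin m) :
    E i * E j = if i = j then E i else 0 := by
  have hsum : ∑ i, (E i).toLinearMap = 1 := by
    rw [← ContinuousLinearMap.toLinearMap_sum, hE.2]
    rfl
  refine ContinuousLinearMap.coe_injective ?_
  rw [apply_ite ContinuousLinearMap.toLinearMap]
  exact mul_eq_ite_of_sum_eq_one hsum hEd.iSupIndep i j

theorem IsOptimalWith.conj_eq [CompleteSpace H] (hA : ∀ i, 0 ≤ A i) (h : IsOptimalWith A E Z)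
    (i : Fin m) : A i * E i * A i = Z * E i * Z := by
  have hZ : star Z = Z := (h.multiplier_nonneg hA).isSelfAdjoint
  have hstar : E i * Z = E i * A i := by
    simpa [hZ, (hA i).isSelfAdjoint.star_eq, (h.povm.1 i).isSelfAdjoint.star_eq]
      using congrArg star (h.mul_eq i)
  rw [← h.mul_eq, mul_assoc, ← hstar, ← mul_assoc]

variable [FiniteDimensional ℂ H]

theorem IsSupportDecomposition.of_finrank_range_le {ι : Type*} [Fintype ι] {A B C : ι → (H →L[ℂ] H)}
    (hA : IsSupportDecomposition A) (hB : ∀ i, 0 ≤ B i) (hunit : IsUnit (∑ i, B i * C i))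
    (hrank : ∀ i, Module.finrank ℂ (LinearMap.range (B i).toLinearMap) ≤
      Module.finrank ℂ (LinearMap.range (A i).toLinearMap)) :
    IsSupportDecomposition B ∧ ∀ i, Module.finrank ℂ (LinearMap.range (B i).toLinearMap) =
      Module.finrank ℂ (LinearMap.range (A i).toLinearMap) := by
  have htop : ⨆ i, LinearMap.range (B i).toLinearMap = ⊤ := by
    refine iSup_range_eq_top_of_isUnit_sum_mul (g := fun i => (C i).toLinearMap) ?_
    convert hunit.map (ContinuousLinearMap.toLinearMapRingHom (R₁ := ℂ) (M₁ := H))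
    rw [map_sum]
    rfl
  obtain ⟨hindep, hfinrank⟩ := iSupIndep_and_finrank_eq_of_iSup_eq_top hA.iSupIndep htop hrank
  exact ⟨⟨hB, hindep, htop⟩, hfinrank⟩

variable [CompleteSpace H]

theorem Ensemble.mem_LIEnsembles_iff {r : Fin m → ℕ} (hr : ∑ i, r i = Module.finrank ℂ H)
    {P : Ensemble m H} :
    P ∈ LIEnsembles H r ↔ IsSupportDecomposition P.weighted ∧
      ∀ i, Module.finrank ℂ (LinearMap.range (P.weighted i).toLinearMap) = r i := by
  have hrange (i : Fin m) := P.range_weighted i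
  have hindep : iSupIndep (fun i => LinearMap.range (P.weighted i).toLinearMap) ↔
      iSupIndep fun i => LinearMap.range (P.ρ i).toLinearMap := by
    rw [funext hrange]
  constructor
  · rintro ⟨hrank, hP⟩
    have hrank' (i : Fin m) :
        Module.finrank ℂ (LinearMap.range (P.weighted i).toLinearMap) = r i := by
      rw [hrange, hrank]
    refine ⟨⟨P.weighted_nonneg, hindep.2 hP, ?_⟩, hrank'⟩
    exact iSup_eq_top_of_iSupIndep_of_sum_finrank_eq (hindep.2 hP) (by simp only [hrank', hr])
  · rintro ⟨hP, hrank⟩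
    exact ⟨fun i => by rw [← hrange, hrank], hindep.1 hP.iSupIndep⟩

namespace IsOptimalWith

theorem isUnit_multiplier (hA : IsSupportDecomposition A) (h : IsOptimalWith A E Z) : IsUnit Z :=
  isUnit_of_iSup_range_eq_top hA.nonneg hA.iSup_eq_top h.le

theorem isSupportDecomposition_povm (hA : IsSupportDecomposition A) (h : IsOptimalWith A E Z) :
    IsSupportDecomposition E ∧ ∀ i, Module.finrank ℂ (LinearMap.range (E i).toLinearMap) =
      Module.finrank ℂ (LinearMap.range (A i).toLinearMap) := by
  obtain ⟨S, -, hSZ⟩ := isUnit_iff_exists.1 (h.isUnit_multiplier hA)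
  refine hA.of_finrank_range_le (C := 1) h.povm.1 ?_ fun i => ?_
  · simp [h.povm.2]
  · have hE : E i = S * (A i * E i) := by rw [← h.mul_eq, ← mul_assoc, hSZ, one_mul]
    rw [hE]
    exact (finrank_range_mul_le_right S.toLinearMap (A i * E i).toLinearMap).trans
      (finrank_range_mul_le_left (A i).toLinearMap (E i).toLinearMap)

theorem isStarProjection (hA : IsSupportDecomposition A) (h : IsOptimalWith A E Z) (i : Fin m) :
    IsStarProjection (E i) where
  isIdempotentElem :=
    (h.povm.mul_eq_ite (h.isSupportDecomposition_povm hA).1 i i).trans (if_pos rfl)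
  isSelfAdjoint := (h.povm.1 i).isSelfAdjoint

theorem range_povm_eq_ker (hA : IsSupportDecomposition A) (h : IsOptimalWith A E Z) (i : Fin m) :
    LinearMap.range (E i).toLinearMap = LinearMap.ker (Z - A i).toLinearMap := by
  obtain ⟨S, -, hSZ⟩ := isUnit_iff_exists.1 (h.isUnit_multiplier hA)
  have hrange : LinearMap.range (E i).toLinearMap ≤ LinearMap.ker (Z - A i).toLinearMap := by
    rintro _ ⟨x, rfl⟩
    have hx : ((Z - A i) * E i) x = 0 := by rw [sub_mul, h.mul_eq, sub_self, _root_.zero_apply]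
    exact hx
  have hker : LinearMap.ker (Z - A i).toLinearMap ≤ LinearMap.range (S * A i).toLinearMap := by
    intro x (hx : Z x - A i x = 0)
    refine ⟨x, ?_⟩
    calc S (A i x) = (S * Z) x := by rw [mul_apply_eq_comp, sub_eq_zero.1 hx]
      _ = x := by rw [hSZ, one_apply_eq_self]
  refine Submodule.eq_of_le_of_finrank_le hrange ((Submodule.finrank_mono hker).trans ?_)
  rw [(h.isSupportDecomposition_povm hA).2]
  exact finrank_range_mul_le_right S.toLinearMap (A i).toLinearMap

theorem povm_eq_starProjection_ker (hA : IsSupportDecomposition A) (h : IsOptimalWith A E Z)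
    (i : Fin m) : E i = (LinearMap.ker (Z - A i).toLinearMap).starProjection := by
  obtain ⟨_, hE⟩ := isStarProjection_iff_eq_starProjection_range.1 (h.isStarProjection hA i)
  simp only [h.range_povm_eq_ker hA] at hE
  exact hE

theorem unique {Z' : H →L[ℂ] H} (hA : IsSupportDecomposition A) (h : IsOptimalWith A E Z)
    (h' : IsOptimalWith A F Z') : E = F ∧ Z = Z' := by
  have hF : IsOptimalWith A F Z := h.of_isMax h'.povm (h'.sum_reTr_le h.povm)
  refine ⟨funext fun i => ?_, hF.multiplier_eq_sum.trans h'.multiplier_eq_sum.symm⟩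
  rw [h.povm_eq_starProjection_ker hA, hF.povm_eq_starProjection_ker hA]

theorem eq_minimalExtension (hA : IsSupportDecomposition A) (h : IsOptimalWith A E Z)
    (i : Fin m) : A i = minimalExtension Z (LinearMap.range (E i).toLinearMap) := by
  refine MED.eq_minimalExtension (h.multiplier_nonneg hA.nonneg) (h.isUnit_multiplier hA)
    (hA.nonneg i).isSelfAdjoint ?_ ((h.isSupportDecomposition_povm hA).2 i).ge
  rintro _ ⟨x, rfl⟩
  exact congrArg (fun T : H →L[ℂ] H => T x) (h.mul_eq i).symm

theorem isSupportDecomposition_conj (hA : IsSupportDecomposition A) (h : IsOptimalWith A E Z) :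
    IsSupportDecomposition (fun i => Z * E i * Z) ∧
      ∀ i, Module.finrank ℂ (LinearMap.range (Z * E i * Z).toLinearMap) =
        Module.finrank ℂ (LinearMap.range (A i).toLinearMap) := by
  have hZ : star Z = Z := (h.multiplier_nonneg hA.nonneg).isSelfAdjoint
  refine hA.of_finrank_range_le (C := 1) (fun i => ?_) ?_ fun i => ?_
  · simpa only [hZ] using star_left_conjugate_nonneg (h.povm.1 i) Z
  · simp only [Pi.one_apply, mul_one, ← Finset.sum_mul, ← Finset.mul_sum, h.povm.2]
    exact (h.isUnit_multiplier hA).mul (h.isUnit_multiplier hA)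
  · rw [h.mul_eq, mul_assoc]
    exact finrank_range_mul_le_left (A i).toLinearMap (E i * Z).toLinearMap

end IsOptimalWith

theorem isOptimalWith_minimalExtension (hE : IsPOVM E) (hZ : 0 ≤ Z) :
    IsOptimalWith (fun i => minimalExtension Z (LinearMap.range (E i).toLinearMap)) E Z where
  povm := hE
  le i := minimalExtension_le hZ _
  mul_eq i := by
    ext x
    exact (minimalExtension_apply_of_mem hZ (LinearMap.mem_range_self (E i).toLinearMap x)).symm

theorem isSupportDecomposition_minimalExtension (hE : IsPOVM E) (hEd : IsSupportDecomposition E)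
    (hZ : 0 ≤ Z) (hZu : IsUnit Z) :
    IsSupportDecomposition (fun i => minimalExtension Z (LinearMap.range (E i).toLinearMap)) ∧
      ∀ i, Module.finrank ℂ (LinearMap.range
          (minimalExtension Z (LinearMap.range (E i).toLinearMap)).toLinearMap) =
        Module.finrank ℂ (LinearMap.range (E i).toLinearMap) := by
  refine hEd.of_finrank_range_le (C := E) (fun i => minimalExtension_nonneg Z _) ?_
    fun i => finrank_range_minimalExtension_le Z _
  rwa [← (isOptimalWith_minimalExtension hE hZ).multiplier_eq_sum]

end SupportDecomposition

section Normalization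

variable {m : ℕ} {H : Type*} [NormedAddCommGroup H] [InnerProductSpace ℂ H] [CompleteSpace H]
  {A B : Fin m → (H →L[ℂ] H)}

namespace Ensemble

theorem weighted_ne_zero (P : Ensemble m H) (i : Fin m) : P.weighted i ≠ 0 := fun h =>
  (P.p_pos i).ne' (by rw [← P.reTr_weighted, h, map_zero])

theorem exists_weighted_eq_smul_iff {Q : Ensemble m H} (hB : ∀ i, 0 ≤ B i) :
    (∃ c : ℝ, 0 < c ∧ ∀ i, Q.weighted i = c • B i) ↔
      (∀ i, Q.ρ i = (reTr (B i))⁻¹ • B i) ∧ ∀ i, Q.p i = reTr (B i) / ∑ l, reTr (B l) := by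
  obtain ⟨i₀⟩ := Q.nonempty
  constructor
  · rintro ⟨c, hc, hQ⟩
    have hp (i : Fin m) : Q.p i = c * reTr (B i) := by
      rw [← reTr_weighted, hQ, map_smul, smul_eq_mul]
    have htotal : 1 = c * ∑ l, reTr (B l) := by
      rw [Finset.mul_sum, ← Finset.sum_congr rfl fun i _ => hp i, Q.sum_p]
    refine ⟨fun i => ?_, fun i => ?_⟩
    · have hBi : reTr (B i) ≠ 0 := right_ne_zero_of_mul (hp i ▸ (Q.p_pos i).ne')
      have hweighted : (c * reTr (B i)) • Q.ρ i = c • B i := by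
        rw [← hp, ← weighted_eq_smul, hQ]
      rw [eq_inv_smul_iff₀ hBi]
      exact smul_right_injective _ hc.ne' (by simpa only [smul_smul] using hweighted)
    · rw [hp, eq_div_iff (right_ne_zero_of_mul (htotal ▸ one_ne_zero)), mul_right_comm, ← htotal,
        one_mul]
  · rintro ⟨hρ, hp⟩
    have htotal : 0 ≤ ∑ l, reTr (B l) := Finset.sum_nonneg fun i _ => reTr_nonneg (hB i)
    have hne (i : Fin m) : reTr (B i) ≠ 0 ∧ ∑ l, reTr (B l) ≠ 0 :=
      div_ne_zero_iff.1 (hp i ▸ (Q.p_pos i).ne')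
    refine ⟨(∑ l, reTr (B l))⁻¹, inv_pos.2 (htotal.lt_of_ne' (hne i₀).2), fun i => ?_⟩
    rw [weighted_eq_smul, hρ, hp, smul_smul, div_mul_eq_mul_div, mul_inv_cancel₀ (hne i).1, one_div]

variable [FiniteDimensional ℂ H]

theorem exists_weighted_eq_smul [Nonempty (Fin m)] (hA : ∀ i, 0 ≤ A i) (hne : ∀ i, A i ≠ 0) :
    ∃ P : Ensemble m H, ∃ c : ℝ, 0 < c ∧ ∀ i, P.weighted i = c • A i := by
  have hpos (i : Fin m) : 0 < reTr (A i) :=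
    (reTr_nonneg (hA i)).lt_of_ne' fun h => hne i (eq_zero_of_reTr_eq_zero (hA i) h)
  have htotal : 0 < ∑ i, reTr (A i) := Finset.sum_pos (fun i _ => hpos i) Finset.univ_nonempty
  let P : Ensemble m H :=
    { p := fun i => reTr (A i) / ∑ l, reTr (A l)
      ρ := fun i => (reTr (A i))⁻¹ • A i
      p_pos := fun i => div_pos (hpos i) htotal
      sum_p := by rw [← Finset.sum_div, div_self htotal.ne']
      ρ_nonneg := fun i => smul_nonneg (inv_pos.2 (hpos i)).le (hA i)
      trace_ρ := fun i => by
        rw [trace_eq_reTr (smul_nonneg (inv_pos.2 (hpos i)).le (hA i)), map_smul, smul_eq_mul,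
          inv_mul_cancel₀ (hpos i).ne', Complex.ofReal_one] }
  exact ⟨P, (exists_weighted_eq_smul_iff hA).2 ⟨fun _ => rfl, fun _ => rfl⟩⟩

theorem ne_zero_of_finrank_range_eq (P : Ensemble m H) {i : Fin m} {T : H →L[ℂ] H}
    (h : Module.finrank ℂ (LinearMap.range T.toLinearMap) =
      Module.finrank ℂ (LinearMap.range (P.weighted i).toLinearMap)) : T ≠ 0 := by
  rintro rfl
  rw [ContinuousLinearMap.toLinearMap_zero, LinearMap.range_zero, finrank_bot, eq_comm,
    Submodule.finrank_eq_zero, LinearMap.range_eq_bot] at h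
  exact P.weighted_ne_zero i (ContinuousLinearMap.coe_injective h)

end Ensemble

end Normalization

section PrettyGoodMeasurement

variable {m : ℕ} {H : Type*} [NormedAddCommGroup H] [InnerProductSpace ℂ H] [CompleteSpace H]
  {Q : Ensemble m H}

theorem rpow_neg_half_mul_sqrt {S : H →L[ℂ] H} (hS : 0 ≤ S) (hSu : IsUnit S) :
    S ^ (-(1 / 2) : ℝ) * CFC.sqrt S = 1 ∧ CFC.sqrt S * S ^ (-(1 / 2) : ℝ) = 1 := by
  have hpos := hSu.isStrictlyPositive hS
  rw [CFC.sqrt_eq_rpow]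
  exact ⟨CFC.rpow_neg_mul_rpow (1 / 2) hpos, CFC.rpow_mul_rpow_neg (1 / 2) hpos⟩

theorem sqrt_avg_mul_pgm_mul_sqrt_avg (hQ : IsUnit Q.avg) (i : Fin m) :
    CFC.sqrt Q.avg * PGM Q i * CFC.sqrt Q.avg = Q.weighted i := by
  obtain ⟨hleft, hright⟩ := rpow_neg_half_mul_sqrt Q.avg_nonneg hQ
  calc CFC.sqrt Q.avg * PGM Q i * CFC.sqrt Q.avg
    _ = (CFC.sqrt Q.avg * Q.avg ^ (-(1 / 2) : ℝ)) * Q.weighted i *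
        (Q.avg ^ (-(1 / 2) : ℝ) * CFC.sqrt Q.avg) := by
      simp only [PGM, Ensemble.weighted, mul_assoc]
    _ = Q.weighted i := by rw [hleft, hright, one_mul, mul_one]

theorem isPOVM_pgm (hQ : IsUnit Q.avg) : IsPOVM (PGM Q) := by
  have hsa : star (Q.avg ^ (-(1 / 2) : ℝ)) = Q.avg ^ (-(1 / 2) : ℝ) :=
    (CFC.rpow_nonneg (a := Q.avg)).isSelfAdjoint
  refine ⟨fun i => ?_, ?_⟩
  · have h := star_left_conjugate_nonneg (Q.weighted_nonneg i) (Q.avg ^ (-(1 / 2) : ℝ))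
    rwa [hsa] at h
  · obtain ⟨hleft, hright⟩ := rpow_neg_half_mul_sqrt Q.avg_nonneg hQ
    calc ∑ i, PGM Q i
      _ = Q.avg ^ (-(1 / 2) : ℝ) * Q.avg * Q.avg ^ (-(1 / 2) : ℝ) := by
        simp only [PGM, ← Finset.sum_mul, ← Finset.mul_sum, Ensemble.avg]
      _ = (Q.avg ^ (-(1 / 2) : ℝ) * CFC.sqrt Q.avg) *
          (CFC.sqrt Q.avg * Q.avg ^ (-(1 / 2) : ℝ)) := by
        rw [← mul_assoc, mul_assoc _ (CFC.sqrt Q.avg) (CFC.sqrt Q.avg),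
          CFC.sqrt_mul_sqrt_self Q.avg Q.avg_nonneg]
      _ = 1 := by rw [hleft, hright, one_mul]

theorem sqrt_avg_eq_and_pgm_eq {E : Fin m → (H →L[ℂ] H)} {Z : H →L[ℂ] H} (hE : ∑ i, E i = 1)
    (hZ : 0 ≤ Z) (hZu : IsUnit Z) (h : ∀ i, Q.weighted i = Z * E i * Z) :
    CFC.sqrt Q.avg = Z ∧ PGM Q = E := by
  have havg : Q.avg = Z * Z := by
    simp only [Q.avg_eq_sum_weighted, h, ← Finset.sum_mul, ← Finset.mul_sum, hE, mul_one]
  have hsqrt : CFC.sqrt Q.avg = Z := by rw [havg, CFC.sqrt_mul_self Z hZ]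
  have hpgm (i : Fin m) := sqrt_avg_mul_pgm_mul_sqrt_avg (havg ▸ hZu.mul hZu) i
  simp only [hsqrt, h] at hpgm
  exact ⟨hsqrt, funext fun i => hZu.mul_right_injective (hZu.mul_left_injective (hpgm i))⟩

variable [FiniteDimensional ℂ H]

theorem IsSupportDecomposition.isUnit_avg (hQ : IsSupportDecomposition Q.weighted) :
    IsUnit Q.avg :=
  isUnit_of_iSup_range_eq_top hQ.nonneg hQ.iSup_eq_top fun i =>
    Finset.single_le_sum (fun j _ => hQ.nonneg j) (Finset.mem_univ i)

theorem IsSupportDecomposition.pgm (hQ : IsSupportDecomposition Q.weighted) :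
    IsSupportDecomposition (PGM Q) ∧
      ∀ i, Module.finrank ℂ (LinearMap.range (PGM Q i).toLinearMap) =
        Module.finrank ℂ (LinearMap.range (Q.weighted i).toLinearMap) := by
  have hE := isPOVM_pgm hQ.isUnit_avg
  refine hQ.of_finrank_range_le (C := 1) hE.1 (by simp [hE.2]) fun i => ?_
  exact (finrank_range_mul_le_left _ (Q.avg ^ (-(1 / 2) : ℝ)).toLinearMap).trans
    (finrank_range_mul_le_right (Q.avg ^ (-(1 / 2) : ℝ)).toLinearMap _)

end PrettyGoodMeasurement

section Transform

variable {m : ℕ} {H : Type*} [NormedAddCommGroup H] [InnerProductSpace ℂ H] [CompleteSpace H]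
  {P P' Q Q' : Ensemble m H} {E : Fin m → (H →L[ℂ] H)} {Z : H →L[ℂ] H}

/-- The basis-free form of the correspondence `P ⟶ Q`: the pretty good measurement of `Q` is optimal
for `P`, and the Lagrange multiplier certifying this is proportional to the square root of the
average state of `Q`. -/
def IsTransform (P Q : Ensemble m H) : Prop :=
  ∃ t : ℝ, 0 < t ∧ IsOptimalWith (t • P.weighted) (PGM Q) (CFC.sqrt Q.avg)

variable [FiniteDimensional ℂ H]

theorem isTransform_iff (hP : IsSupportDecomposition P.weighted) :
    IsTransform P Q ↔ ∃ E Z, IsOptimalWith P.weighted E Z ∧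
      ∃ c : ℝ, 0 < c ∧ ∀ i, Q.weighted i = c • (Z * E i * Z) := by
  constructor
  · rintro ⟨t, ht, h⟩
    have hQ : IsUnit Q.avg :=
      (CFC.isUnit_sqrt_iff Q.avg Q.avg_nonneg).1 (h.isUnit_multiplier (hP.smul ht))
    refine ⟨PGM Q, t⁻¹ • CFC.sqrt Q.avg, ?_, t * t, by positivity, fun i => ?_⟩
    · have h' := h.smul (inv_nonneg.2 ht.le)
      rwa [inv_smul_smul₀ ht.ne'] at h'
    · rw [smul_mul_assoc, smul_mul_smul_comm, sqrt_avg_mul_pgm_mul_sqrt_avg hQ, ← mul_inv,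
        smul_inv_smul₀ (by positivity)]
  · rintro ⟨E, Z, h, c, hc, hQ⟩
    have hc' := Real.sqrt_pos.2 hc
    have h' := h.smul hc'.le
    obtain ⟨hsqrt, hpgm⟩ := sqrt_avg_eq_and_pgm_eq (Q := Q) h'.povm.2
      (h'.multiplier_nonneg (hP.smul hc').nonneg) (h'.isUnit_multiplier (hP.smul hc')) fun i => by
        rw [hQ, smul_mul_assoc, smul_mul_smul_comm, Real.mul_self_sqrt hc.le]
    exact ⟨√c, hc', by rwa [hsqrt, hpgm]⟩

theorem exists_isTransform (hP : IsSupportDecomposition P.weighted) : ∃ Q, IsTransform P Q := by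
  obtain ⟨E, hE⟩ := exists_isOptimalPOVM P
  obtain ⟨Z, hZ⟩ := isOptimalPOVM_iff_exists_isOptimalWith.1 hE
  obtain ⟨hdecomp, hrank⟩ := hZ.isSupportDecomposition_conj hP
  have := P.nonempty
  obtain ⟨Q, hQ⟩ := Ensemble.exists_weighted_eq_smul hdecomp.nonneg fun i =>
    P.ne_zero_of_finrank_range_eq (hrank i)
  exact ⟨Q, (isTransform_iff hP).2 ⟨E, Z, hZ, hQ⟩⟩

theorem exists_isTransform_of_isSupportDecomposition_right
    (hQ : IsSupportDecomposition Q.weighted) :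
    ∃ P, IsTransform P Q ∧ IsSupportDecomposition P.weighted ∧
      ∀ i, Module.finrank ℂ (LinearMap.range (P.weighted i).toLinearMap) =
        Module.finrank ℂ (LinearMap.range (Q.weighted i).toLinearMap) := by
  set Z := CFC.sqrt Q.avg
  set A := fun i => minimalExtension Z (LinearMap.range (PGM Q i).toLinearMap)
  have hZu : IsUnit Z := (CFC.isUnit_sqrt_iff Q.avg Q.avg_nonneg).2 hQ.isUnit_avg
  have hE := isPOVM_pgm hQ.isUnit_avg
  obtain ⟨hA, hrank⟩ :=
    isSupportDecomposition_minimalExtension hE hQ.pgm.1 (CFC.sqrt_nonneg Q.avg) hZu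
  have := Q.nonempty
  obtain ⟨P, c, hc, hP⟩ := Ensemble.exists_weighted_eq_smul hA.nonneg fun i =>
    Q.ne_zero_of_finrank_range_eq ((hrank i).trans (hQ.pgm.2 i))
  have hPA : P.weighted = c • A := funext hP
  refine ⟨P, ⟨c⁻¹, inv_pos.2 hc, ?_⟩, hPA ▸ hA.smul hc, fun i => ?_⟩
  · rw [hPA, inv_smul_smul₀ hc.ne']
    exact isOptimalWith_minimalExtension hE (CFC.sqrt_nonneg Q.avg)
  · rw [hP, ← hQ.pgm.2, ← hrank, range_real_smul hc.ne']

namespace IsTransform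

theorem right_unique (hP : IsSupportDecomposition P.weighted) (h : IsTransform P Q)
    (h' : IsTransform P Q') : Q = Q' := by
  obtain ⟨E, Z, hE, c, -, hQ⟩ := (isTransform_iff hP).1 h
  obtain ⟨E', Z', hE', c', hc', hQ'⟩ := (isTransform_iff hP).1 h'
  obtain ⟨rfl, rfl⟩ := hE.unique hP hE'
  exact Ensemble.eq_of_weighted_eq_smul (c := c * c'⁻¹) fun i => by
    rw [hQ, hQ', mul_smul, inv_smul_smul₀ hc'.ne']

theorem left_unique (hP : IsSupportDecomposition P.weighted)
    (hP' : IsSupportDecomposition P'.weighted) (h : IsTransform P Q) (h' : IsTransform P' Q) :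
    P = P' := by
  obtain ⟨t, ht, hE⟩ := h
  obtain ⟨t', ht', hE'⟩ := h'
  refine Ensemble.eq_of_weighted_eq_smul (c := t⁻¹ * t') fun i => ?_
  have heq : t • P.weighted i = t' • P'.weighted i :=
    (hE.eq_minimalExtension (hP.smul ht) i).trans (hE'.eq_minimalExtension (hP'.smul ht') i).symm
  rw [mul_smul, ← heq, inv_smul_smul₀ ht.ne']

theorem mem_LIEnsembles {r : Fin m → ℕ} (hr : ∑ i, r i = Module.finrank ℂ H)
    (hP : P ∈ LIEnsembles H r) (h : IsTransform P Q) : Q ∈ LIEnsembles H r := by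
  obtain ⟨hPd, hrank⟩ := (Ensemble.mem_LIEnsembles_iff hr).1 hP
  obtain ⟨E, Z, hE, c, hc, hQ⟩ := (isTransform_iff hPd).1 h
  obtain ⟨hd, hdrank⟩ := hE.isSupportDecomposition_conj hPd
  have hQd : Q.weighted = c • fun i => Z * E i * Z := funext hQ
  refine (Ensemble.mem_LIEnsembles_iff hr).2 ⟨hQd ▸ hd.smul hc, fun i => ?_⟩
  rw [hQ, ← hrank, ← hdrank, range_real_smul hc.ne']

theorem isOptimalPOVM_iff (hP : IsSupportDecomposition P.weighted) (h : IsTransform P Q) :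
    IsOptimalPOVM P E ↔ E = PGM Q := by
  obtain ⟨t, ht, hQ⟩ := h
  have hQ' := hQ.smul (inv_nonneg.2 ht.le)
  rw [inv_smul_smul₀ ht.ne'] at hQ'
  rw [isOptimalPOVM_iff_exists_isOptimalWith]
  exact ⟨fun ⟨Z, hZ⟩ => (hZ.unique hP hQ').1, fun hE => ⟨_, hE ▸ hQ'⟩⟩

end IsTransform

theorem pgm_mem_projMeasurements {r : Fin m → ℕ} (hr : ∑ i, r i = Module.finrank ℂ H)
    (hQ : Q ∈ LIEnsembles H r) : PGM Q ∈ ProjMeasurements H r := by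
  obtain ⟨hQd, hrank⟩ := (Ensemble.mem_LIEnsembles_iff hr).1 hQ
  have hE := isPOVM_pgm hQd.isUnit_avg
  exact ⟨hE, fun i => (hQd.pgm.2 i).trans (hrank i), hE.mul_eq_ite hQd.pgm.1⟩

theorem exists_mem_LIEnsembles_isTransform {r : Fin m → ℕ} (hr : ∑ i, r i = Module.finrank ℂ H)
    (hQ : Q ∈ LIEnsembles H r) : ∃ P ∈ LIEnsembles H r, IsTransform P Q := by
  obtain ⟨hQd, hrank⟩ := (Ensemble.mem_LIEnsembles_iff hr).1 hQ
  obtain ⟨P, hPQ, hP, hPrank⟩ := exists_isTransform_of_isSupportDecomposition_right hQd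
  exact ⟨P, (Ensemble.mem_LIEnsembles_iff hr).2 ⟨hP, fun i => (hPrank i).trans (hrank i)⟩, hPQ⟩

end Transform

section RankOne

variable {ι 𝕜 E : Type*} [Fintype ι] [RCLike 𝕜] [NormedAddCommGroup E] [InnerProductSpace 𝕜 E]

theorem range_sum_rankOne_le_span (v : ι → E) :
    LinearMap.range (∑ j, InnerProductSpace.rankOne 𝕜 (v j) (v j)).toLinearMap ≤
      Submodule.span 𝕜 (Set.range v) := by
  rintro _ ⟨x, rfl⟩
  rw [ContinuousLinearMap.coe_coe, _root_.sum_apply]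
  exact Submodule.sum_mem _ fun j _ =>
    Submodule.smul_mem _ _ (Submodule.subset_span (Set.mem_range_self j))

theorem sum_rankOne_map_eq_conj [CompleteSpace E] (T : E →L[𝕜] E) (v : ι → E) :
    ∑ j, InnerProductSpace.rankOne 𝕜 (T (v j)) (T (v j)) =
      T * (∑ j, InnerProductSpace.rankOne 𝕜 (v j) (v j)) * star T := by
  ext x
  simp only [_root_.sum_apply, InnerProductSpace.rankOne_apply, mul_apply_eq_comp, map_sum,
    map_smul, ContinuousLinearMap.star_eq_adjoint, ContinuousLinearMap.adjoint_inner_right]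

theorem exists_orthonormalBasis_inner_apply_eq_ite [FiniteDimensional 𝕜 E] {Z : E →L[𝕜] E}
    (hZ : Z.toLinearMap.IsSymmetric) (L : Submodule 𝕜 E) {k : ℕ}
    (hk : Module.finrank 𝕜 L = k) :
    ∃ (b : OrthonormalBasis (Fin k) 𝕜 L) (a : Fin k → ℝ),
      ∀ j l, inner 𝕜 (b j : E) (Z (b l)) = if j = l then (a j : 𝕜) else 0 := by
  have hsymm : (L.orthogonalProjectionOnto ∘L Z ∘L L.subtypeL).toLinearMap.IsSymmetric := by
    intro x y
    simpa using hZ x y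
  refine ⟨hsymm.eigenvectorBasis hk, hsymm.eigenvalues hk, fun j l => ?_⟩
  have heigen : L.orthogonalProjectionOnto (Z (hsymm.eigenvectorBasis hk l)) =
      (hsymm.eigenvalues hk l : 𝕜) • hsymm.eigenvectorBasis hk l :=
    hsymm.apply_eigenvectorBasis hk l
  rw [← Submodule.inner_orthogonalProjectionOnto_eq_of_mem_left, heigen, inner_smul_right,
    OrthonormalBasis.inner_eq_ite]
  split_ifs with h <;> simp [h]

theorem linearIndependent_of_iSup_range_sum_rankOne_eq_top {κ : ι → Type*}
    [∀ i, Fintype (κ i)] {ψ : (i : ι) × κ i → E}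
    (hcard : ∑ i, Fintype.card (κ i) = Module.finrank 𝕜 E)
    (h : ⨆ i, LinearMap.range
      (∑ j, InnerProductSpace.rankOne 𝕜 (ψ ⟨i, j⟩) (ψ ⟨i, j⟩)).toLinearMap = ⊤) :
    LinearIndependent 𝕜 ψ := by
  refine linearIndependent_of_top_le_span_of_card_eq_finrank ?_ (by rw [Fintype.card_sigma, hcard])
  rw [← h]
  exact iSup_le fun i => (range_sum_rankOne_le_span fun j => ψ ⟨i, j⟩).trans
    (Submodule.span_mono (Set.range_comp_subset_range (Sigma.mk i) ψ))

end RankOne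

section CrossGram

variable {n 𝕜 E : Type*} [RCLike 𝕜] [NormedAddCommGroup E] [InnerProductSpace 𝕜 E]

/-- The matrix of inner products between the vectors of two families; for `w = ψ` it is the Gram
matrix. It gives the coefficients of `w` in the system dual to `ψ`. -/
def crossGram (𝕜 : Type*) [RCLike 𝕜] [InnerProductSpace 𝕜 E] (ψ w : n → E) : Matrix n n 𝕜 :=
  .of fun a b => inner 𝕜 (ψ a) (w b)

theorem crossGram_apply (ψ w : n → E) (a b : n) :
    crossGram 𝕜 ψ w a b = inner 𝕜 (ψ a) (w b) := rfl

variable [Fintype n]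

theorem crossGram_mul_star {w : n → E}
    (hw : ∑ b, InnerProductSpace.rankOne 𝕜 (w b) (w b) = 1) (ψ : n → E) :
    crossGram 𝕜 ψ w * star (crossGram 𝕜 ψ w) = Matrix.gram 𝕜 ψ := by
  ext a b
  have hexpand : ψ b = ∑ d, inner 𝕜 (w d) (ψ b) • w d := by
    simpa [_root_.sum_apply] using (congrArg (fun T : E →L[𝕜] E => T (ψ b)) hw).symm
  rw [Matrix.gram_apply, hexpand, inner_sum, Matrix.mul_apply]
  refine Finset.sum_congr rfl fun d _ => ?_
  rw [inner_smul_right, Matrix.star_apply, crossGram_apply, crossGram_apply, mul_comm]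
  exact congrArg (· * _) (inner_conj_symm _ _)

theorem inner_sum_smul_eq_crossGram_mul (ψ w : n → E) (M : Matrix n n 𝕜) (a b : n) :
    inner 𝕜 (ψ a) (∑ d, M d b • w d) = (crossGram 𝕜 ψ w * M) a b := by
  rw [inner_sum, Matrix.mul_apply]
  exact Finset.sum_congr rfl fun d _ => by rw [inner_smul_right, crossGram_apply, mul_comm]

theorem sum_smul_sum_smul_eq_mul (w : n → E) (M N : Matrix n n 𝕜) (b : n) :
    ∑ a, N a b • ∑ d, M d a • w d = ∑ d, (M * N) d b • w d := by
  simp only [Finset.smul_sum, smul_smul, Matrix.mul_apply, Finset.sum_smul]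
  rw [Finset.sum_comm]
  simp only [mul_comm]

theorem isUnit_crossGram [DecidableEq n] {ψ w : n → E}
    (hψ : LinearIndependent 𝕜 ψ) (hw : ∑ b, InnerProductSpace.rankOne 𝕜 (w b) (w b) = 1) :
    IsUnit (crossGram 𝕜 ψ w) := by
  have hgram := (Matrix.posDef_gram_of_linearIndependent hψ).isUnit
  rw [← crossGram_mul_star hw ψ, Matrix.isUnit_iff_isUnit_det, Matrix.det_mul] at hgram
  exact (Matrix.isUnit_iff_isUnit_det _).2 (isUnit_of_mul_isUnit_left hgram)

theorem exists_unitary_eq_sqrt_mul_star_mul [DecidableEq n] {Y : Matrix n n ℂ} (hY : IsUnit Y) :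
    ∃ W ∈ Matrix.unitaryGroup n ℂ, Y = CFC.sqrt (Y * star Y) * W := by
  set S := CFC.sqrt (Y * star Y)
  have hnonneg : 0 ≤ Y * star Y := mul_star_self_nonneg Y
  have hSS : S * S = Y * star Y := CFC.sqrt_mul_sqrt_self _ hnonneg
  have hdet : IsUnit S.det := (Matrix.isUnit_iff_isUnit_det S).1 <|
    (CFC.isUnit_sqrt_iff _ hnonneg).2 (hY.mul hY.star)
  have hSinv : star S⁻¹ = S⁻¹ := by
    have hS : star S = S := (CFC.sqrt_nonneg _).isSelfAdjoint
    exact (Matrix.conjTranspose_nonsing_inv S).trans (congrArg _ hS)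
  refine ⟨S⁻¹ * Y, ?_, by rw [← mul_assoc, Matrix.mul_nonsing_inv S hdet, one_mul]⟩
  rw [Matrix.mem_unitaryGroup_iff, star_mul, hSinv]
  calc S⁻¹ * Y * (star Y * S⁻¹) = S⁻¹ * (Y * star Y) * S⁻¹ := by simp only [mul_assoc]
    _ = (S⁻¹ * S) * (S * S⁻¹) := by rw [← hSS]; simp only [mul_assoc]
    _ = 1 := by rw [Matrix.nonsing_inv_mul S hdet, Matrix.mul_nonsing_inv S hdet, one_mul]

end CrossGram

section SimultaneousDecomposition

variable {H : Type*} [NormedAddCommGroup H] [InnerProductSpace ℂ H] [CompleteSpace H]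
  {Z : H →L[ℂ] H}

theorem crossGram_inv_sqrt_smul_apply {n : Type*} [DecidableEq n] (hZ : IsSelfAdjoint Z)
    (f : n → H) {a : n → ℝ}
    (hf : ∀ j l, inner ℂ (f j) (Z (f l)) = if j = l then (a j : ℂ) else 0) :
    crossGram ℂ (fun j => (√(a j) : ℂ)⁻¹ • Z (f j)) f = Matrix.diagonal fun j => (√(a j) : ℂ) := by
  ext j l
  have hsqrt : (√(a j) : ℂ)⁻¹ * (a j : ℂ) = √(a j) := by
    rw [inv_mul_eq_div, ← Complex.ofReal_div, Real.div_sqrt]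
  have hsymm : inner ℂ (Z (f j)) (f l) = inner ℂ (f j) (Z (f l)) := hZ.isSymmetric (f j) (f l)
  rw [crossGram_apply, inner_smul_left, hsymm, hf, map_inv₀, Complex.conj_ofReal, mul_ite, mul_zero,
    hsqrt, Matrix.diagonal_apply]

variable [FiniteDimensional ℂ H] {L : Submodule ℂ H} {k : ℕ}

theorem minimalExtension_eq_sum_rankOne (hZ : 0 ≤ Z) (hZu : IsUnit Z)
    (b : OrthonormalBasis (Fin k) ℂ L) {a : Fin k → ℝ} (ha : ∀ j, 0 < a j)
    (hba : ∀ j l, inner ℂ (b j : H) (Z (b l)) = if j = l then (a j : ℂ) else 0) :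
    minimalExtension Z L = ∑ j, InnerProductSpace.rankOne ℂ ((√(a j) : ℂ)⁻¹ • Z (b j))
      ((√(a j) : ℂ)⁻¹ • Z (b j)) := by
  let ψ : Fin k → H := fun j => (√(a j) : ℂ)⁻¹ • Z (b j)
  have hinner (j l : Fin k) : inner ℂ (ψ j) (b l : H) = if j = l then (√(a j) : ℂ) else 0 := by
    rw [← Matrix.diagonal_apply fun j => (√(a j) : ℂ),
      ← crossGram_inv_sqrt_smul_apply hZ.isSelfAdjoint _ hba, crossGram_apply]
  let A := ∑ j, InnerProductSpace.rankOne ℂ (ψ j) (ψ j)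
  have hA : IsSelfAdjoint A :=
    isSelfAdjoint_sum _ fun j _ => (InnerProductSpace.isPositive_rankOne_self (ψ j)).isSelfAdjoint
  have hAZ : A.toLinearMap ∘ₗ L.subtype = Z.toLinearMap ∘ₗ L.subtype :=
    b.toBasis.ext fun l => by
      have hl : (√(a l) : ℂ) ≠ 0 := Complex.ofReal_ne_zero.2 (Real.sqrt_pos.2 (ha l)).ne'
      have hAl : A (b l) = ∑ j, inner ℂ (ψ j) (b l : H) • ψ j := by
        simp only [A, _root_.sum_apply, InnerProductSpace.rankOne_apply]
      have hψl : √(a l) • ψ l = Z (b l) := (Complex.coe_smul _ _).symm.trans (smul_inv_smul₀ hl _)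
      simpa [hinner, hψl] using hAl
  refine (eq_minimalExtension hZ hZu hA (fun x hx => LinearMap.congr_fun hAZ ⟨x, hx⟩) ?_).symm
  calc Module.finrank ℂ (LinearMap.range A.toLinearMap)
    _ ≤ Module.finrank ℂ (Submodule.span ℂ (Set.range ψ)) :=
      Submodule.finrank_mono (range_sum_rankOne_le_span ψ)
    _ ≤ Fintype.card (Fin k) := finrank_range_le_card ψ
    _ = Module.finrank ℂ L := (Module.finrank_eq_card_basis b.toBasis).symm

theorem exists_rankOne_decompositions_crossGram_posSemidef (hZ : 0 ≤ Z) (hZu : IsUnit Z)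
    (hk : Module.finrank ℂ L = k) :
    ∃ ψ w : Fin k → H, minimalExtension Z L = ∑ j, InnerProductSpace.rankOne ℂ (ψ j) (ψ j) ∧
      L.starProjection = ∑ j, InnerProductSpace.rankOne ℂ (w j) (w j) ∧
      (crossGram ℂ ψ w).PosSemidef := by
  obtain ⟨b, a, hba⟩ :=
    exists_orthonormalBasis_inner_apply_eq_ite hZ.isSelfAdjoint.isSymmetric L hk
  replace hba (j l : Fin k) :
      inner ℂ (b j : H) (Z (b l)) = if j = l then (a j : ℂ) else 0 := hba j l
  have ha (j : Fin k) : 0 < a j := by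
    have haj : (a j : ℂ) = (‖CFC.sqrt Z (b j)‖ ^ 2 : ℝ) := by
      calc (a j : ℂ) = inner ℂ (b j : H) (Z (b j)) := ((hba j j).trans (if_pos rfl)).symm
        _ = inner ℂ (Z (b j)) (b j : H) := (hZ.isSelfAdjoint.isSymmetric (b j) (b j)).symm
        _ = _ := inner_apply_self_eq_norm_sqrt_sq hZ _
    have hinj := (ContinuousLinearMap.isUnit_iff_bijective.1 ((CFC.isUnit_sqrt_iff Z hZ).2 hZu)).1
    have hne : CFC.sqrt Z (b j) ≠ 0 := (map_ne_zero_iff _ hinj).2 <|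
      Submodule.coe_eq_zero.not.2 (b.orthonormal.ne_zero j)
    rw [Complex.ofReal_inj.1 haj]
    positivity
  refine ⟨_, fun j => b j, minimalExtension_eq_sum_rankOne hZ hZu b ha hba,
    b.starProjection_eq_sum_rankOne, ?_⟩
  rw [crossGram_inv_sqrt_smul_apply hZ.isSelfAdjoint _ hba, Matrix.posSemidef_diagonal_iff]
  exact fun j => by exact_mod_cast Real.sqrt_nonneg (a j)

end SimultaneousDecomposition

section Correspondence

variable {m : ℕ} {H : Type*} [NormedAddCommGroup H] [InnerProductSpace ℂ H] {r : Fin m → ℕ}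

theorem chi_crossGram (ψ w : (i : Fin m) × Fin (r i) → H) (i : Fin m) (j : Fin (r i)) :
    chi (crossGram ℂ ψ w) ψ i j =
      (∑ k, InnerProductSpace.rankOne ℂ (ψ ⟨i, k⟩) (ψ ⟨i, k⟩)) (w ⟨i, j⟩) := by
  simp only [chi, Matrix.blockDiag'_apply, crossGram_apply, _root_.sum_apply,
    InnerProductSpace.rankOne_apply]

variable [CompleteSpace H] {P Q : Ensemble m H} {E : Fin m → (H →L[ℂ] H)} {Z : H →L[ℂ] H}

theorem IsOptimalWith.sum_rankOne_chi (h : IsOptimalWith P.weighted E Z)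
    {ψ w : (i : Fin m) × Fin (r i) → H} {i : Fin m}
    (hψ : P.weighted i = ∑ j, InnerProductSpace.rankOne ℂ (ψ ⟨i, j⟩) (ψ ⟨i, j⟩))
    (hw : E i = ∑ j, InnerProductSpace.rankOne ℂ (w ⟨i, j⟩) (w ⟨i, j⟩)) :
    ∑ j, InnerProductSpace.rankOne ℂ (chi (crossGram ℂ ψ w) ψ i j)
      (chi (crossGram ℂ ψ w) ψ i j) = Z * E i * Z := by
  simp only [chi_crossGram, ← hψ]
  rw [sum_rankOne_map_eq_conj (P.weighted i) fun j => w ⟨i, j⟩, ← hw,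
    (P.weighted_nonneg i).isSelfAdjoint.star_eq, h.conj_eq P.weighted_nonneg]

variable [FiniteDimensional ℂ H]

theorem Ensemble.exists_weighted_eq_smul_sum_rankOne_iff (χ : (i : Fin m) → Fin (r i) → H) :
    (∃ c : ℝ, 0 < c ∧
        ∀ i, Q.weighted i = c • ∑ j, InnerProductSpace.rankOne ℂ (χ i j) (χ i j)) ↔
      (∀ i, Q.ρ i = ((1 / ∑ k, ‖χ i k‖ ^ 2 : ℝ) : ℂ) •
          ∑ j, InnerProductSpace.rankOne ℂ (χ i j) (χ i j)) ∧
        ∀ i, Q.p i = (∑ j, ‖χ i j‖ ^ 2) / ∑ l, ∑ k, ‖χ l k‖ ^ 2 := by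
  rw [exists_weighted_eq_smul_iff fun i => Finset.sum_nonneg fun j _ =>
    (ContinuousLinearMap.nonneg_iff_isPositive _).2
      (InnerProductSpace.isPositive_rankOne_self (χ i j))]
  simp only [reTr_sum_rankOne_self, one_div, Complex.coe_smul]

theorem Corresponds.isTransform (hP : IsSupportDecomposition P.weighted)
    (h : Corresponds r P Q) : IsTransform P Q := by
  obtain ⟨E, ψ, u, w, W, Y, hE, hψ, hu, -, -, hw, hEw, -, hρ, hp⟩ := h
  obtain ⟨Z, hZ⟩ := isOptimalPOVM_iff_exists_isOptimalWith.1 hE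
  have hY : Y = crossGram ℂ ψ w := by
    ext a b
    simp [crossGram_apply, hw, hu, inner_sum, inner_smul_right]
  refine (isTransform_iff hP).2 ⟨E, Z, hZ, ?_⟩
  obtain ⟨c, hc, hQ⟩ := (Ensemble.exists_weighted_eq_smul_sum_rankOne_iff (chi Y ψ)).2 ⟨hρ, hp⟩
  exact ⟨c, hc, fun i => by rw [hQ, hY, hZ.sum_rankOne_chi (hψ i) (hEw i)]⟩

theorem IsOptimalWith.exists_rankOne_decompositions (hP : IsSupportDecomposition P.weighted)
    (hrank : ∀ i, Module.finrank ℂ (LinearMap.range (P.weighted i).toLinearMap) = r i)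
    (h : IsOptimalWith P.weighted E Z) :
    ∃ ψ w : (i : Fin m) × Fin (r i) → H,
      (∀ i, P.weighted i = ∑ j, InnerProductSpace.rankOne ℂ (ψ ⟨i, j⟩) (ψ ⟨i, j⟩)) ∧
      (∀ i, E i = ∑ j, InnerProductSpace.rankOne ℂ (w ⟨i, j⟩) (w ⟨i, j⟩)) ∧
      ∀ i, ((crossGram ℂ ψ w).blockDiag' i).PosSemidef := by
  have hErank (i : Fin m) : Module.finrank ℂ (LinearMap.range (E i).toLinearMap) = r i :=
    ((h.isSupportDecomposition_povm hP).2 i).trans (hrank i)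
  choose ψ w hψ hw hpos using fun i => exists_rankOne_decompositions_crossGram_posSemidef
    (h.multiplier_nonneg hP.nonneg) (h.isUnit_multiplier hP) (hErank i)
  refine ⟨fun a => ψ a.1 a.2, fun a => w a.1 a.2, fun i => ?_, fun i => ?_, hpos⟩
  · rw [h.eq_minimalExtension hP i, hψ]
  · obtain ⟨_, hE⟩ := isStarProjection_iff_eq_starProjection_range.1 (h.isStarProjection hP i)
    exact hE.trans (hw i)

theorem IsTransform.corresponds (hr : ∑ i, r i = Module.finrank ℂ H) (hP : P ∈ LIEnsembles H r)
    (h : IsTransform P Q) : Corresponds r P Q := by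
  obtain ⟨hPd, hrank⟩ := (Ensemble.mem_LIEnsembles_iff hr).1 hP
  obtain ⟨E, Z, hE, c, hc, hQ⟩ := (isTransform_iff hPd).1 h
  obtain ⟨ψ, w, hψ, hw, hpos⟩ := hE.exists_rankOne_decompositions hPd hrank
  have hwsum : ∑ b, InnerProductSpace.rankOne ℂ (w b) (w b) = 1 := by
    rw [Fintype.sum_sigma, ← hE.povm.2]
    exact Finset.sum_congr rfl fun i _ => (hw i).symm
  have hψind : LinearIndependent ℂ ψ := by
    refine linearIndependent_of_iSup_range_sum_rankOne_eq_top (by simp [hr]) ?_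
    simp only [← hψ]
    exact hPd.iSup_eq_top
  set Y := crossGram ℂ ψ w
  have hY : IsUnit Y := isUnit_crossGram hψind hwsum
  have hdet : IsUnit Y.det := (Matrix.isUnit_iff_isUnit_det Y).1 hY
  obtain ⟨W, hW, hYW⟩ := exists_unitary_eq_sqrt_mul_star_mul hY
  rw [crossGram_mul_star hwsum ψ] at hYW
  obtain ⟨hρ, hp⟩ := (Ensemble.exists_weighted_eq_smul_sum_rankOne_iff (chi Y ψ)).1
    ⟨c, hc, fun i => by rw [hQ, hE.sum_rankOne_chi (hψ i) (hw i)]⟩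
  refine ⟨E, ψ, fun b => ∑ d, Y⁻¹ d b • w d, w, W, Y,
    isOptimalPOVM_iff_exists_isOptimalWith.2 ⟨Z, hE⟩, hψ, fun a b => ?_, hW, hYW, fun b => ?_, hw,
    hpos, hρ, hp⟩
  · rw [inner_sum_smul_eq_crossGram_mul, Matrix.mul_nonsing_inv Y hdet, Matrix.one_apply]
  · rw [sum_smul_sum_smul_eq_mul, Matrix.nonsing_inv_mul Y hdet]
    simp [Matrix.one_apply]

theorem corresponds_iff_isTransform (hr : ∑ i, r i = Module.finrank ℂ H)
    (hP : P ∈ LIEnsembles H r) : Corresponds r P Q ↔ IsTransform P Q :=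
  ⟨fun h => h.isTransform ((Ensemble.mem_LIEnsembles_iff hr).1 hP).1, fun h => h.corresponds hr hP⟩

end Correspondence

end MED

end

theorem mainTheorem2 {H : Type*} [NormedAddCommGroup H] [InnerProductSpace ℂ H] [CompleteSpace H]
    [FiniteDimensional ℂ H] {m : ℕ} (r : Fin m → ℕ) (hr : ∑ i, r i = Module.finrank ℂ H) :
    ∃ R : MED.LIEnsembles H r → MED.LIEnsembles H r,
      (∀ (P : MED.LIEnsembles H r) (Q : MED.Ensemble m H),
        MED.Corresponds r P.1 Q ↔ Q = (R P).1) ∧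
      Function.Injective R ∧
      Function.Surjective R ∧
      ∀ P : MED.LIEnsembles H r,
        MED.PGM (R P).1 ∈ MED.ProjMeasurements H r ∧
        ∀ E : Fin m → (H →L[ℂ] H), MED.IsOptimalPOVM P.1 E ↔ E = MED.PGM (R P).1 := by
  have hdecomp (P : MED.LIEnsembles H r) := ((MED.Ensemble.mem_LIEnsembles_iff hr).1 P.2).1
  choose T hT using fun P : MED.LIEnsembles H r => MED.exists_isTransform (hdecomp P)
  have hTmem (P : MED.LIEnsembles H r) : T P ∈ MED.LIEnsembles H r := (hT P).mem_LIEnsembles hr P.2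
  refine ⟨fun P => ⟨T P, hTmem P⟩, fun P Q => ?_, fun P P' hPP' => ?_, fun Q => ?_, fun P =>
    ⟨MED.pgm_mem_projMeasurements hr (hTmem P), fun E => (hT P).isOptimalPOVM_iff (hdecomp P)⟩⟩
  · rw [MED.corresponds_iff_isTransform hr P.2]
    exact ⟨fun h => h.right_unique (hdecomp P) (hT P), fun h => h ▸ hT P⟩
  · have hTP : T P = T P' := congrArg Subtype.val hPP'
    exact Subtype.ext ((hT P).left_unique (hdecomp P) (hdecomp P') (hTP ▸ hT P'))
  · obtain ⟨P, hP, hPQ⟩ := MED.exists_mem_LIEnsembles_isTransform hr Q.2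
    exact ⟨⟨P, hP⟩, Subtype.ext ((hT ⟨P, hP⟩).right_unique (hdecomp ⟨P, hP⟩) hPQ)⟩
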